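/- **Lemma (time-uniform a priori estimates on cumulants).** Let $d\ge1$, $\beta>0$, let $\mathbb T^d=(\mathbb R/\mathbb Z)^d$ and $\mathbb D=\mathbb T^d\times\mathbb R^d$, let $V\in W^{4,\infty}(\mathbb T^d)$ be real-valued, even and positive definite (that is, $\widehat V\ge0$), and let $M_\beta(v)=(\frac{\beta}{2\pi})^{d/2}e^{-\frac\beta2|v|^2}$. Let $f^\circ:\mathbb R^d\to[0,\infty)$ be a probability density. For $N\ge1$ consider $N+1$ particles in $\mathbb D$ with positions $x_j$ and velocities $v_j$, $0\le j\le N$, obeying $$\frac{d}{dt}x_j=v_j,\qquad \frac{d}{dt}v_j=-\frac1N\sum_{0\le l\le N,\ l\ne j}\nabla V(x_j-x_l),$$ whose initial configuration is distributed with density $$F_N^\circ(z_0,\dots,z_N)=f^\circ(v_0)\,Z_{N,\beta}^{-1}\exp\Big(-\frac\beta2\sum_{j=1}^N|v_j|^2-\frac{\beta}{2N}\sum_{1\le j\ne l\le N}V(x_j-x_l)\Big),\qquad z_j=(x_j,v_j),$$ where $Z_{N,\beta}$ normalizes the Gibbs factor on $\mathbb D^N$. The law of the configuration at time $t\ge0$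 is absolutely continuous; let $F_N^t$ be its density on $\mathbb D^{N+1}$ and, for $0\le m\le N$, let $$F_N^{m+1;t}(z_0,\dots,z_m)=\int_{\mathbb D^{N-m}}F_N^t(z_0,\dots,z_N)\,dz_{m+1}\cdots dz_N,$$ $$G_N^{m+1;t}(z_0,\dots,z_m)=\sum_{j=0}^m(-1)^{m-j}\sum_{\sigma\subset\{1,\dots,m\},\ |\sigma|=j}\frac{F_N^{j+1;t}}{M_\beta^{\otimes(j+1)}}(z_0,z_\sigma).$$ Write $\|G\|_{L^p_\beta(\mathbb D^k)}=\big(\int_{\mathbb D^k}|G|^pM_\beta^{\otimes k}\big)^{1/p}$. If for some $q\in(1,\infty)$ $$\frac{f^\circ}{M_\beta}\in L^{2q}_\beta(\mathbb D)\qquad\text{and}\qquad \beta\|V\|_{L^\infty(\mathbb T^d)}<\frac{4(q-1)}{2q-1},$$ then for all $0\le m\le N$ and all $t\ge0$ we have $G_N^{m+1;t}\in L^2_\beta(\mathbb D^{m+1})$ and $$\|G_N^{m+1;t}\|_{L^2_\beta(\mathbb D^{m+1})}\le C\,N^{-m/2}\,\Big\|\frac{f^\circ}{M_\beta}\Big\|_{L^{2q}_\beta(\mathbb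 D)},$$ where the constant $C>0$ depends only on $d,\beta,q,m$ (in particular not on $N$, $t$, $f^\circ$ or $V$). -/

import Mathlib

open MeasureTheory

namespace TaggedParticle

/-- The velocity space `ℝ^d`, with its Euclidean norm. -/
abbrev Vel (d : ℕ) : Type := EuclideanSpace ℝ (Fin d)

/-- The flat torus `𝕋^d = (ℝ/ℤ)^d`, of unit volume (so that dual variables lie in `2πℤ^d`). -/
abbrev Torus (d : ℕ) : Type := UnitAddTorus (Fin d)

/-- The one-particle phase space `𝔻 = 𝕋^d × ℝ^d`; `z.1` is the position, `z.2` the velocity. -/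
abbrev Phase (d : ℕ) : Type := Torus d × Vel d

/-- The projection `ℝ^d → 𝕋^d`. -/
def toTorus {d : ℕ} (y : Vel d) : Torus d := fun i => ((y i : ℝ) : UnitAddCircle)

/-- The gradient `∇V(x)` of `V : 𝕋^d → ℝ` at a point `x` of the torus. -/
noncomputable def grad {d : ℕ} (V : Torus d → ℝ) (x : Torus d) : Vel d :=
  gradient (fun y : Vel d => V (x + toTorus y)) 0

/-- The interaction potentials: `V : 𝕋^d → ℝ` even, positive definite (all Fourier coefficients
are real and nonnegative), and of class `W^{4,∞}(𝕋^d)`. The latter is expressed, as usual, by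
requiring that `V` (its continuous representative, read on `ℝ^d` as a periodic function) is
three times continuously differentiable with Lipschitz third derivative. -/
structure IsPotential {d : ℕ} (V : Torus d → ℝ) : Prop where
  even : ∀ x, V (-x) = V x
  contDiff : ContDiff ℝ 3 (fun y : Vel d => V (toTorus y))
  lipschitz : ∃ K, LipschitzWith K (iteratedFDeriv ℝ 3 (fun y : Vel d => V (toTorus y)))
  fourier_re : ∀ k : Fin d → ℤ, 0 ≤ (UnitAddTorus.mFourierCoeff (fun x => (V x : ℂ)) k).re
  fourier_im : ∀ k : Fin d → ℤ, (UnitAddTorus.mFourierCoeff (fun x => (V x : ℂ)) k).im = 0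

/-- `γ` solves Newton's equations for the tagged particle (label `0`) and the `N` background
particles (labels `1, …, N`), for all times:
`x_j' = v_j` and `v_j' = -(1/N) ∑_{l ≠ j} ∇V(x_j - x_l)`.
The derivative of the position on the torus is that of a lift `X j` of the position to `ℝ^d`. -/
def IsNewtonTrajectory {d N : ℕ} (V : Torus d → ℝ) (γ : ℝ → Fin (N + 1) → Phase d) : Prop :=
  ∃ X : Fin (N + 1) → ℝ → Vel d, ∀ (j : Fin (N + 1)) (t : ℝ),
    (γ t j).1 = toTorus (X j t) ∧
    HasDerivAt (X j) (γ t j).2 t ∧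
    HasDerivAt (fun s => (γ s j).2)
      (-(1 / (N : ℝ)) • ∑ l ∈ Finset.univ.erase j, grad V ((γ t j).1 - (γ t l).1)) t

open Classical in
/-- The flow of Newton's equations: `newtonFlow V t z` is the position at time `t` of the (unique)
trajectory that starts at `z` at time `0`. (For a Lipschitz force it exists for every `z`;
the other branch only makes the definition total.) -/
noncomputable def newtonFlow {d N : ℕ} (V : Torus d → ℝ) (t : ℝ) (z : Fin (N + 1) → Phase d) :
    Fin (N + 1) → Phase d :=
  if h : ∃ γ : ℝ → Fin (N + 1) → Phase d, IsNewtonTrajectory V γ ∧ γ 0 = z then h.choose t else z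

/-- The Maxwellian `M_β(v) = (β/2π)^{d/2} exp(-β|v|²/2)`. -/
noncomputable def maxwellian {d : ℕ} (β : ℝ) (v : Vel d) : ℝ :=
  (β / (2 * Real.pi)) ^ ((d : ℝ) / 2) * Real.exp (-(β / 2) * ‖v‖ ^ 2)

/-- The tensorized Maxwellian `M_β^{⊗k}` as a function on `𝔻^k`. -/
noncomputable def maxwellianProd {d k : ℕ} (β : ℝ) (z : Fin k → Phase d) : ℝ :=
  ∏ j, maxwellian β (z j).2

/-- The measure `M_β^{⊗k} dz` on `𝔻^k`. The norm of `L^p_β(𝔻^k)` is the `L^p` norm with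
respect to it. -/
noncomputable def maxwellMeasure (d k : ℕ) (β : ℝ) : Measure (Fin k → Phase d) :=
  volume.withDensity (fun z => ENNReal.ofReal (maxwellianProd β z))

/-- The unnormalized Gibbs density
`exp(-(β/2) ∑_j |v_j|² - (β/2N) ∑_{j ≠ l} V(x_j - x_l))` of the `N` background particles. -/
noncomputable def gibbsWeight {d N : ℕ} (β : ℝ) (V : Torus d → ℝ) (z : Fin N → Phase d) : ℝ :=
  Real.exp (-(β / 2) * ∑ j, ‖(z j).2‖ ^ 2
    - β / (2 * (N : ℝ)) * ∑ j, ∑ l ∈ Finset.univ.erase j, V ((z j).1 - (z l).1))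

/-- The Gibbs density `M_{N,β} = Z_{N,β}⁻¹ exp(…)`, a probability density on `𝔻^N`. -/
noncomputable def gibbs {d N : ℕ} (β : ℝ) (V : Torus d → ℝ) (z : Fin N → Phase d) : ℝ :=
  (∫ w : Fin N → Phase d, gibbsWeight β V w)⁻¹ * gibbsWeight β V z

/-- The initial density `F_N°(z_0, …, z_N) = f°(v_0) M_{N,β}(z_1, …, z_N)`. -/
noncomputable def initialDensity {d N : ℕ} (β : ℝ) (V : Torus d → ℝ) (f : Vel d → ℝ)
    (z : Fin (N + 1) → Phase d) : ℝ :=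
  f (z 0).2 * gibbs β V (fun j : Fin N => z j.succ)

/-- The law at time `t` of the `N + 1` particles that follow Newton's equations with initial
configuration distributed according to `F_N°`. -/
noncomputable def law {d : ℕ} (N : ℕ) (β : ℝ) (V : Torus d → ℝ) (f : Vel d → ℝ) (t : ℝ) :
    Measure (Fin (N + 1) → Phase d) :=
  Measure.map (newtonFlow V t)
    (volume.withDensity (fun z => ENNReal.ofReal (initialDensity β V f z)))

/-- The density `F_N^t` of the law of the particles at time `t`, with respect to Lebesgue measure on
`𝔻^{N+1}`. -/
noncomputable def density {d : ℕ} (N : ℕ) (β : ℝ) (V : Torus d → ℝ) (f : Vel d → ℝ) (t : ℝ)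
    (z : Fin (N + 1) → Phase d) : ℝ :=
  ((law N β V f t).rnDeriv volume z).toReal

/-- The marginal of `F : 𝔻^{N+1} → ℝ` in its first `k` entries (for `k ≤ N + 1`): the
last `N + 1 - k` entries are integrated out. -/
noncomputable def marginal {d N : ℕ} (F : (Fin (N + 1) → Phase d) → ℝ) (k : ℕ)
    (z : Fin k → Phase d) : ℝ :=
  ∫ w : Fin (N + 1 - k) → Phase d,
    F (fun i => if h : (i : ℕ) < k then z ⟨i, h⟩ else w ⟨(i : ℕ) - k, by omega⟩)

/-- The point `(z_0, z_σ)`, for `z = (z_0, …, z_m)` and a subset `σ = {i_1 < … < i_j}` of the labels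
`{1, …, m}` (the label `i + 1` is encoded by `i : Fin m`). -/
def select {d m : ℕ} (z : Fin (m + 1) → Phase d) (σ : Finset (Fin m)) :
    Fin (σ.card + 1) → Phase d :=
  Fin.cons (z 0) (fun i : Fin σ.card => z (σ.orderEmbOfFin rfl i).succ)

/-- The linear cumulant
`G^{m+1}(z_0, …, z_m) = ∑_{j=0}^m (-1)^{m-j} ∑_{|σ| = j} (F^{j+1} / M_β^{⊗(j+1)})(z_0, z_σ)`,
where `σ` runs over the subsets of `{1, …, m}` and `F^{j+1}` is the marginal of order `j + 1`. -/
noncomputable def cumulant {d N : ℕ} (β : ℝ) (F : (Fin (N + 1) → Phase d) → ℝ) (m : ℕ)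
    (z : Fin (m + 1) → Phase d) : ℝ :=
  ∑ σ : Finset (Fin m), (-1 : ℝ) ^ (m - σ.card) *
    (marginal F (σ.card + 1) (select z σ) / maxwellianProd β (select z σ))

end TaggedParticle

namespace TaggedParticle

/-! The estimate combines an `L²` bound on the full `(N+1)`-particle density, uniform in `N` and
`t`, with orthogonality of the cumulants.

Uniform bound. The energy is conserved and the flow does not increase Lebesgue measure, so the `L²`
norm of the density with weight `exp (β * energy)` cannot grow (`lintegral_sq_mul_le_of_map_le`).
This weight must be compared with the inverse Maxwellian without losing a factor exponential in `N`.
Subtracting the mean of `V` affects neither the Gibbs density nor the conservation law. After that,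
positive definiteness bounds the interaction energy below by `-2‖V‖_∞` (`interaction_centered_ge`),
its Maxwellian mean is zero, so the partition function is at least that of free particles
(`gibbs_le`), and inserting the tagged particle costs at most `2‖V‖_∞` (`interaction_succ_le`). No
upper bound on the interaction energy is required. Since `4(q-1)/(2q-1) < 2`, smallness enters as
`β‖V‖_∞ ≤ 2`, and `lintegral_rnDeriv_law_sq_le` then has the absolute constant `exp 12`; finally
`L²_β` is controlled by `L^{2q}_β`.

Decay in `N`. Under the product Maxwellian, a probability measure, the marginals divided by
Maxwellians are conditional expectations of the relative density, and the cumulants are the terms of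
its Hoeffding decomposition in the background variables. Terms for different label sets of size `m`
are orthogonal, and by exchangeability all `N.choose m` of them have the same norm. Bessel's
inequality (`choose_mul_norm_alternatingSum_sq_le`) bounds `N.choose m` times the squared norm of
one cumulant by the uniform bound, and `N.choose m` is of order `N ^ m`.

Measurability, the half of Liouville's theorem used here, and the label symmetry of the flow all
come from the symplectic Euler scheme, whose steps are compositions of two shears and which
converges to the flow pointwise. -/

instance : IsProbabilityMeasure (volume : Measure UnitAddCircle) :=
  ⟨by simp [AddCircle.volume_eq_smul_haarAddCircle]⟩

theorem volume_torus_eq (d : ℕ) : (volume : Measure (Torus d)) =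
    Measure.pi fun _ : Fin d => (AddCircle.haarAddCircle : Measure UnitAddCircle) := by
  have : (volume : Measure UnitAddCircle) = AddCircle.haarAddCircle := by
    rw [AddCircle.volume_eq_smul_haarAddCircle]; simp
  rw [← this]; rfl

/-! ### Positive definite functions on the torus -/

section Fourier

variable {d : ℕ}

theorem mFourierCoeff_eq_integral (f : Torus d → ℂ) (n : Fin d → ℤ) :
    UnitAddTorus.mFourierCoeff f n = ∫ t, UnitAddTorus.mFourier (-n) t * f t := by
  rw [volume_torus_eq]; rfl

/-- Polarized Parseval identity, for functions rather than `Lp` classes. -/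
theorem hasSum_conj_mFourierCoeff_mul {f g : Torus d → ℂ} (hf : MemLp f 2) (hg : MemLp g 2) :
    HasSum (fun i => (starRingEnd ℂ) (UnitAddTorus.mFourierCoeff f i) *
      UnitAddTorus.mFourierCoeff g i) (∫ t, (starRingEnd ℂ) (f t) * g t) := by
  have hc : ∀ u v : Torus d → ℂ, u =ᵐ[volume] v → ∀ n,
      UnitAddTorus.mFourierCoeff u n = UnitAddTorus.mFourierCoeff v n := by
    intro u v huv n
    rw [mFourierCoeff_eq_integral, mFourierCoeff_eq_integral]
    exact integral_congr_ae (huv.mono fun x hx => by simp [hx])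
  rw [volume_torus_eq] at *
  have key := UnitAddTorus.hasSum_prod_mFourierCoeff (hf.toLp f) (hg.toLp g)
  have e1 := hf.coeFn_toLp
  have e2 := hg.coeFn_toLp
  convert! key using 1
  · ext i
    rw [hc _ _ e1, hc _ _ e2]
  · refine integral_congr_ae ?_
    filter_upwards [e1, e2] with x h1 h2
    rw [h1, h2]

theorem mFourier_add_apply (n : Fin d → ℤ) (x y : Torus d) :
    UnitAddTorus.mFourier n (x + y) = UnitAddTorus.mFourier n x * UnitAddTorus.mFourier n y := by
  simp only [UnitAddTorus.mFourier, ContinuousMap.coe_mk, Pi.add_apply,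
    fourier_apply, smul_add, AddCircle.toCircle_add, Circle.coe_mul, Finset.prod_mul_distrib]

theorem norm_mFourier_apply (n : Fin d → ℤ) (x : Torus d) :
    ‖UnitAddTorus.mFourier n x‖ = 1 := by
  simp only [UnitAddTorus.mFourier, ContinuousMap.coe_mk, fourier_apply, norm_prod]
  exact Finset.prod_eq_one fun b _ => Circle.norm_coe _

theorem integrable_prod_of_bound {α : Type*} [MeasurableSpace α] {μ : Measure α}
    [IsProbabilityMeasure μ] {F : α × α → ℂ} (hF : Measurable F) (C : ℝ)
    (hC : ∀ p, ‖F p‖ ≤ C) : Integrable F (μ.prod μ) :=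
  (integrable_const C).mono' hF.aestronglyMeasurable (ae_of_all _ hC)

theorem mFourierCoeff_convolution {V g : Torus d → ℂ} (hV : Measurable V) (hg : Measurable g)
    {A B : ℝ} (hVA : ∀ x, ‖V x‖ ≤ A) (hgB : ∀ x, ‖g x‖ ≤ B) (n : Fin d → ℤ) :
    UnitAddTorus.mFourierCoeff (fun x => ∫ y, V (x - y) * g y) n =
      UnitAddTorus.mFourierCoeff V n * UnitAddTorus.mFourierCoeff g n := by
  simp only [mFourierCoeff_eq_integral]
  have hm : Measurable (fun x : Torus d => UnitAddTorus.mFourier (-n) x) :=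
    (UnitAddTorus.mFourier (-n)).continuous.measurable
  have hA : 0 ≤ A := (norm_nonneg _).trans (hVA 0)
  have hint : Integrable (Function.uncurry fun x y : Torus d =>
      UnitAddTorus.mFourier (-n) x * (V (x - y) * g y)) (volume.prod volume) := by
    refine integrable_prod_of_bound ?_ (A * B) ?_
    · exact (hm.comp measurable_fst).mul
        ((hV.comp (measurable_fst.sub measurable_snd)).mul (hg.comp measurable_snd))
    · rintro ⟨x, y⟩
      simp only [Function.uncurry, norm_mul, norm_mFourier_apply, one_mul]
      exact mul_le_mul (hVA _) (hgB _) (norm_nonneg _) hA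
  simp_rw [← integral_const_mul]
  rw [integral_integral_swap hint]
  congr 1
  ext y
  have : ∀ x, UnitAddTorus.mFourier (-n) x * (V (x - y) * g y) =
      (fun z => UnitAddTorus.mFourier (-n) z * V z) (x - y) *
        (UnitAddTorus.mFourier (-n) y * g y) := by
    intro x
    have := mFourier_add_apply (-n) (x - y) y
    rw [sub_add_cancel] at this
    simp only [this]; ring
  simp_rw [this]
  rw [integral_mul_const, integral_sub_right_eq_self
    (fun z => UnitAddTorus.mFourier (-n) z * V z) y]

theorem mFourierCoeff_zero (f : Torus d → ℂ) : UnitAddTorus.mFourierCoeff f 0 = ∫ t, f t := by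
  simp [mFourierCoeff_eq_integral, UnitAddTorus.mFourier_zero]

/-- A bounded function with nonnegative Fourier coefficients defines a nonnegative quadratic form,
bounded below by the contribution of the zero mode. -/
theorem integral_mul_sq_le_of_mFourierCoeff_nonneg {V g : Torus d → ℝ} (hV : Measurable V)
    (hg : Measurable g) {A B : ℝ} (hVA : ∀ x, |V x| ≤ A) (hgB : ∀ x, |g x| ≤ B)
    (hre : ∀ k, 0 ≤ (UnitAddTorus.mFourierCoeff (fun x => (V x : ℂ)) k).re)
    (him : ∀ k, (UnitAddTorus.mFourierCoeff (fun x => (V x : ℂ)) k).im = 0) :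
    (∫ x, V x) * (∫ x, g x) ^ 2 ≤ ∫ x, g x * ∫ y, V (x - y) * g y := by
  have hA : 0 ≤ A := (abs_nonneg _).trans (hVA 0)
  have hVc : Measurable fun x => (V x : ℂ) := Complex.measurable_ofReal.comp hV
  have hgc : Measurable fun x => (g x : ℂ) := Complex.measurable_ofReal.comp hg
  have hVAc : ∀ x, ‖(V x : ℂ)‖ ≤ A := by simpa using hVA
  have hgBc : ∀ x, ‖(g x : ℂ)‖ ≤ B := by simpa using hgB
  set u : Torus d → ℂ := fun x => ∫ y, (V (x - y) : ℂ) * (g y : ℂ) with hu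
  have hum : Measurable u := by
    have : Measurable (Function.uncurry fun x y : Torus d => (V (x - y) : ℂ) * (g y : ℂ)) :=
      (hVc.comp (measurable_fst.sub measurable_snd)).mul (hgc.comp measurable_snd)
    exact this.stronglyMeasurable.integral_prod_right.measurable
  have hub : ∀ x, ‖u x‖ ≤ A * B := by
    intro x
    refine (norm_integral_le_of_norm_le_const (C := A * B) (ae_of_all _ fun y => ?_)).trans
      (by simp)
    rw [norm_mul]
    exact mul_le_mul (hVAc _) (hgBc _) (norm_nonneg _) hA
  have key := hasSum_conj_mFourierCoeff_mul
    (MemLp.of_bound hgc.aestronglyMeasurable B (ae_of_all volume hgBc))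
    (MemLp.of_bound hum.aestronglyMeasurable _ (ae_of_all volume hub))
  have hterm : ∀ k, (starRingEnd ℂ) (UnitAddTorus.mFourierCoeff (fun x => (g x : ℂ)) k) *
      UnitAddTorus.mFourierCoeff u k =
      (((UnitAddTorus.mFourierCoeff (fun x => (V x : ℂ)) k).re *
        ‖UnitAddTorus.mFourierCoeff (fun x => (g x : ℂ)) k‖ ^ 2 : ℝ) : ℂ) := by
    intro k
    rw [hu, mFourierCoeff_convolution hVc hgc hVAc hgBc]
    have h1 : UnitAddTorus.mFourierCoeff (fun x => (V x : ℂ)) k =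
        ((UnitAddTorus.mFourierCoeff (fun x => (V x : ℂ)) k).re : ℂ) :=
      Complex.ext (by simp) (by simpa using him k)
    rw [h1, mul_left_comm, Complex.conj_mul']
    push_cast
    simp
  simp_rw [hterm] at key
  have hsum : (∫ x, (starRingEnd ℂ) (g x : ℂ) * u x) =
      ((∫ x, g x * ∫ y, V (x - y) * g y : ℝ) : ℂ) := by
    rw [← integral_complex_ofReal]
    congr 1; ext x
    rw [hu]
    simp only [Complex.conj_ofReal, Complex.ofReal_mul]
    rw [← integral_complex_ofReal]
    simp
  rw [hsum, Complex.hasSum_ofReal] at key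
  -- Every term of the Parseval series is nonnegative, so the series dominates its zero mode.
  refine le_trans (le_of_eq ?_) (le_hasSum key 0 fun k _ => mul_nonneg (hre k) (sq_nonneg _))
  rw [mFourierCoeff_zero, mFourierCoeff_zero, integral_complex_ofReal, integral_complex_ofReal]
  simp

theorem uniform_continuous_abs {V : Torus d → ℝ} (hV : Continuous V) {δ : ℝ} (hδ : 0 < δ) :
    ∃ ε > 0, ∀ x y : Torus d, dist x y < ε → |V x - V y| < δ := by
  have := CompactSpace.uniformContinuous_of_continuous hV
  obtain ⟨ε, hε, h⟩ := Metric.uniformContinuous_iff.1 this δ hδ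
  exact ⟨ε, hε, fun x y hxy => by simpa [Real.dist_eq] using h hxy⟩

/-- Pointwise positivity: the discrete interaction energy is bounded below by its mean. -/
theorem sum_sum_ge_of_mFourierCoeff_nonneg {V : Torus d → ℝ} (hV : Continuous V)
    (hre : ∀ k, 0 ≤ (UnitAddTorus.mFourierCoeff (fun x => (V x : ℂ)) k).re)
    (him : ∀ k, (UnitAddTorus.mFourierCoeff (fun x => (V x : ℂ)) k).im = 0)
    {ι : Type*} [Fintype ι] (x : ι → Torus d) :
    (Fintype.card ι : ℝ) ^ 2 * ∫ y, V y ≤ ∑ j, ∑ l, V (x j - x l) := by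
  obtain ⟨A, hA⟩ : ∃ A, ∀ y, |V y| ≤ A := by
    obtain ⟨A, hA⟩ := isCompact_univ.exists_bound_of_continuousOn hV.continuousOn
    exact ⟨A, fun y => hA y (Set.mem_univ y)⟩
  refine le_of_forall_pos_le_add fun δ' hδ' => ?_
  obtain ⟨δ, hδ, hδδ⟩ : ∃ δ > 0, (Fintype.card ι : ℝ) ^ 2 * δ ≤ δ' := by
    refine ⟨δ' / ((Fintype.card ι : ℝ) ^ 2 + 1), by positivity, ?_⟩
    rw [mul_div_assoc', div_le_iff₀ (by positivity)]
    nlinarith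
  obtain ⟨ε, hε, hVε⟩ := uniform_continuous_abs hV hδ
  -- Each point is smeared over a ball so small that `V (y - z)` stays within `δ` of `V (x j - x
  -- l)`. The quadratic form then applies to the bounded function `g`, and the ball volume cancels
  -- as `c ^ 2` on both sides.
  set χ : ι → Torus d → ℝ := fun j => (Metric.ball (x j) (ε / 2)).indicator 1 with hχ
  have hχm : ∀ j, Measurable (χ j) := fun j =>
    measurable_one.indicator Metric.isOpen_ball.measurableSet
  have hχ0 : ∀ j y, 0 ≤ χ j y := fun j y => Set.indicator_nonneg (fun _ _ => zero_le_one) y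
  have hχ1 : ∀ j y, χ j y ≤ 1 := fun j y =>
    Set.indicator_le_self' (fun _ _ => zero_le_one) y
  have hχi : ∀ j, Integrable (χ j) := fun j =>
    (integrable_const (1 : ℝ)).mono' (hχm j).aestronglyMeasurable
      (ae_of_all _ fun y => by rw [Real.norm_of_nonneg (hχ0 j y)]; exact hχ1 j y)
  set c : ℝ := volume.real (Metric.ball (0 : Torus d) (ε / 2)) with hc
  have hcpos : 0 < c := by
    rw [hc, Measure.real, ENNReal.toReal_pos_iff]
    exact ⟨Metric.measure_ball_pos _ _ (by positivity), measure_lt_top _ _⟩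
  have hcint : ∀ j, ∫ y, χ j y = c := by
    intro j
    rw [hχ, integral_indicator_one Metric.isOpen_ball.measurableSet, Measure.real,
      Measure.addHaar_ball_center]
    rfl
  set g : Torus d → ℝ := fun y => ∑ j, χ j y with hg
  have hgm : Measurable g := Finset.measurable_sum _ fun j _ => hχm j
  have hgB : ∀ y, |g y| ≤ Fintype.card ι := fun y => by
    rw [abs_of_nonneg (Finset.sum_nonneg fun j _ => hχ0 j y)]
    exact (Finset.sum_le_sum fun j _ => hχ1 j y).trans (by simp)
  have hgi : ∫ y, g y = Fintype.card ι * c := by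
    rw [hg, integral_finsetSum _ fun j _ => hχi j]
    simp [hcint]
  have key := integral_mul_sq_le_of_mFourierCoeff_nonneg hV.measurable hgm hA hgB hre him
  have hpt : ∀ y z j l, χ j y * (V (y - z) * χ l z) ≤ χ j y * ((V (x j - x l) + δ) * χ l z) := by
    intro y z j l
    by_cases hy : y ∈ Metric.ball (x j) (ε / 2)
    · by_cases hz : z ∈ Metric.ball (x l) (ε / 2)
      · have : dist (y - z) (x j - x l) < ε := by
          refine (dist_sub_sub_le _ _ _ _).trans_lt ?_
          linarith [Metric.mem_ball.1 hy, Metric.mem_ball.1 hz]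
        have := (abs_lt.1 (hVε _ _ this)).2
        exact mul_le_mul_of_nonneg_left
          (mul_le_mul_of_nonneg_right (by linarith) (hχ0 _ _)) (hχ0 _ _)
      · simp [hχ, hz]
    · simp [hχ, hy]
  have hsmallint : ∀ y j, Integrable fun z => V (y - z) * χ j z := fun y j =>
    (hχi j).bdd_mul (c := A) (hV.measurable.comp (measurable_const.sub measurable_id)).aestronglyMeasurable
      (ae_of_all _ fun z => hA _)
  have hin : ∀ y, g y * ∫ z, V (y - z) * g z ≤
      ∑ j, ∑ l, χ j y * ((V (x j - x l) + δ) * c) := by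
    intro y
    have : ∫ z, V (y - z) * g z = ∑ l, ∫ z, V (y - z) * χ l z := by
      rw [← integral_finsetSum _ fun l _ => hsmallint y l]
      simp only [hg, Finset.mul_sum]
    rw [this, hg, Finset.sum_mul_sum]
    refine Finset.sum_le_sum fun j _ => Finset.sum_le_sum fun l _ => ?_
    rw [← hcint l, ← integral_const_mul, ← integral_const_mul, ← integral_const_mul]
    exact integral_mono ((hsmallint y l).const_mul _) (((hχi l).const_mul _).const_mul _)
      fun z => hpt y z j l
  have hint2 : Integrable fun y => ∑ j, ∑ l, χ j y * ((V (x j - x l) + δ) * c) :=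
    integrable_finsetSum _ fun j _ => integrable_finsetSum _ fun l _ => (hχi j).mul_const _
  have hle : ∫ y, g y * ∫ z, V (y - z) * g z ≤
      ∑ j, ∑ l, c * ((V (x j - x l) + δ) * c) := by
    have : ∫ y, ∑ j, ∑ l, χ j y * ((V (x j - x l) + δ) * c) =
        ∑ j, ∑ l, c * ((V (x j - x l) + δ) * c) := by
      rw [integral_finsetSum _ fun j _ => integrable_finsetSum _ fun l _ => (hχi j).mul_const _]
      refine Finset.sum_congr rfl fun j _ => ?_
      rw [integral_finsetSum _ fun l _ => (hχi j).mul_const _]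
      exact Finset.sum_congr rfl fun l _ => by rw [integral_mul_const, hcint]
    rw [← this]
    refine integral_mono ?_ hint2 hin
    have hm : Measurable fun y => ∫ z, V (y - z) * g z := by
      have : Measurable (Function.uncurry fun x y : Torus d => V (x - y) * g y) :=
        (hV.measurable.comp (measurable_fst.sub measurable_snd)).mul (hgm.comp measurable_snd)
      exact this.stronglyMeasurable.integral_prod_right.measurable
    refine (integrable_const (Fintype.card ι * (A * Fintype.card ι))).mono'
      (hgm.mul hm).aestronglyMeasurable (ae_of_all _ fun y => ?_)
    rw [norm_mul]
    refine mul_le_mul (hgB y) ?_ (norm_nonneg _) (by positivity)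
    refine (norm_integral_le_of_norm_le_const (C := A * Fintype.card ι)
      (ae_of_all _ fun z => ?_)).trans (by simp)
    rw [norm_mul]
    exact mul_le_mul (hA _) (hgB _) (norm_nonneg _) ((abs_nonneg _).trans (hA 0))
  have hfin : ∑ j, ∑ l, c * ((V (x j - x l) + δ) * c) =
      c ^ 2 * (∑ j, ∑ l, V (x j - x l) + (Fintype.card ι : ℝ) ^ 2 * δ) := by
    have : ∀ j l, c * ((V (x j - x l) + δ) * c) = c ^ 2 * V (x j - x l) + c ^ 2 * δ :=
      fun j l => by ring
    simp_rw [this, Finset.sum_add_distrib, ← Finset.mul_sum]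
    simp only [Finset.sum_const, Finset.card_univ, nsmul_eq_mul]
    ring
  have : c ^ 2 * ((Fintype.card ι : ℝ) ^ 2 * ∫ y, V y) ≤
      c ^ 2 * (∑ j, ∑ l, V (x j - x l) + (Fintype.card ι : ℝ) ^ 2 * δ) := by
    rw [← hfin]
    refine le_trans (le_of_eq ?_) (key.trans hle)
    rw [hgi]; ring
  have := le_of_mul_le_mul_left this (by positivity)
  linarith

end Fourier

/-! ### Global existence for Lipschitz vector fields -/

section ODE

open Set Metric
open scoped Manifold NNReal

variable {E : Type*} [NormedAddCommGroup E] [NormedSpace ℝ E] [CompleteSpace E]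

/-- The existence time depends on the Lipschitz constant but not on `x`; this uniformity is what
permits continuation to all times. -/
theorem exists_local_solution {v : E → E} {M : ℝ≥0} (hM : LipschitzWith M v) (x : E) :
    ∃ γ : ℝ → E, γ 0 = x ∧
      ∀ t ∈ Ioo (-(1 / (2 * ((M : ℝ) + 1)))) (1 / (2 * ((M : ℝ) + 1))),
        HasDerivAt γ (v (γ t)) t := by
  set T : ℝ := 1 / (2 * ((M : ℝ) + 1)) with hT
  have hTpos : 0 < T := by positivity
  have h0 : (0 : ℝ) ∈ Icc (-T) T := ⟨by linarith, hTpos.le⟩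
  -- The radius grows with `‖v x‖`, as does the bound of `v` on the ball, so that speed times `T` is
  -- at most the radius for every `x`.
  have hpl : IsPicardLindelof (fun _ : ℝ => v) (⟨0, h0⟩ : Icc (-T) T) x (‖v x‖₊ + 1) 0
      (‖v x‖₊ + M * (‖v x‖₊ + 1)) M := by
    refine ⟨fun t _ => hM.lipschitzOnWith, fun _ _ => continuousOn_const, fun t _ y hy => ?_, ?_⟩
    · have h1 : ‖v y - v x‖ ≤ M * ‖y - x‖ := hM.norm_sub_le y x
      have h2 : ‖y - x‖ ≤ ‖v x‖ + 1 := by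
        rw [← dist_eq_norm]; exact mem_closedBall.1 hy
      have h3 : ‖v y‖ ≤ ‖v x‖ + ‖v y - v x‖ := by
        simpa using norm_add_le (v x) (v y - v x)
      have h4 := mul_le_mul_of_nonneg_left h2 M.coe_nonneg
      push_cast
      linarith
    · have : max (T - 0) (0 - -T) = T := by simp
      simp only [this]
      push_cast
      rw [hT, mul_one_div, div_le_iff₀ (by positivity)]
      have := norm_nonneg (v x)
      have := M.coe_nonneg
      nlinarith [mul_nonneg (norm_nonneg (v x)) M.coe_nonneg]
  obtain ⟨γ, hγ0, hγ⟩ := hpl.exists_eq_forall_mem_Icc_hasDerivWithinAt₀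
  exact ⟨γ, hγ0, fun t ht =>
    (hγ t (Ioo_subset_Icc_self ht)).hasDerivAt (Icc_mem_nhds ht.1 ht.2)⟩

/-- A globally Lipschitz vector field of class `C¹` has global integral curves. -/
theorem exists_global_solution {v : E → E} {M : ℝ≥0} (hM : LipschitzWith M v)
    (hv : ContDiff ℝ 1 v) (x : E) :
    ∃ γ : ℝ → E, γ 0 = x ∧ ∀ t, HasDerivAt γ (v (γ t)) t := by
  have hv' : ContMDiff 𝓘(ℝ, E) (𝓘(ℝ, E).tangent) 1
      (fun y => (⟨y, v y⟩ : TangentBundle 𝓘(ℝ, E) E)) :=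
    contMDiff_vectorSpace_iff_contDiff.2 hv
  obtain ⟨γ, hγ0, hγ⟩ := exists_isMIntegralCurve_of_isMIntegralCurveOn (I := 𝓘(ℝ, E)) (M := E)
    (v := v) hv' (ε := 1 / (2 * ((M : ℝ) + 1))) (by positivity) (fun y => by
      obtain ⟨γ, hγ0, hγ⟩ := exists_local_solution hM y
      exact ⟨γ, hγ0, fun t ht => (hγ t ht).hasFDerivAt.hasMFDerivAt.hasMFDerivWithinAt⟩) x
  refine ⟨γ, hγ0, fun t => ?_⟩
  have h : HasFDerivAt γ ((1 : ℝ →L[ℝ] ℝ).smulRight (v (γ t)) : ℝ →L[ℝ] E) t :=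
    hasMFDerivAt_iff_hasFDerivAt.1 (hγ t)
  simpa using h.hasDerivAt

theorem exists_global_newton_solution {F : E → E} {M : ℝ≥0} (hM : LipschitzWith M F)
    (hF : ContDiff ℝ 1 F) (x y : E) :
    ∃ X Y : ℝ → E, X 0 = x ∧ Y 0 = y ∧ ∀ t, HasDerivAt X (Y t) t ∧ HasDerivAt Y (F (X t)) t := by
  have hL : LipschitzWith (max 1 M) (fun p : E × E => (p.2, F p.1)) := by
    have h1 : LipschitzWith 1 (fun p : E × E => p.2) := LipschitzWith.prod_snd
    have h2 : LipschitzWith (M * 1) (fun p : E × E => F p.1) := hM.comp LipschitzWith.prod_fst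
    rw [mul_one] at h2
    exact h1.prodMk h2
  obtain ⟨γ, hγ0, hγ⟩ := exists_global_solution hL
    (contDiff_snd.prodMk (hF.comp contDiff_fst)) (x, y)
  refine ⟨fun t => (γ t).1, fun t => (γ t).2, by simp [hγ0], by simp [hγ0], fun t => ⟨?_, ?_⟩⟩
  · exact (hasFDerivAt_fst.comp_hasDerivAt t (hγ t))
  · exact (hasFDerivAt_snd.comp_hasDerivAt t (hγ t))

end ODE

/-! ### Convergence of the symplectic Euler scheme -/

section Euler

open Set
open scoped NNReal Topology

variable {E : Type*} [NormedAddCommGroup E] [NormedSpace ℝ E]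

/-- One step of the symplectic Euler scheme for `x'' = F x`. -/
def eulerStep (F : E → E) (h : ℝ) (p : E × E) : E × E :=
  (p.1 + h • (p.2 + h • F p.1), p.2 + h • F p.1)

/-- Mean value inequality for `X t - t • a`. -/
theorem norm_sub_sub_smul_le {X X' : ℝ → E} {a : E} {C s h : ℝ} (hh : 0 ≤ h)
    (hX : ∀ t, HasDerivAt X (X' t) t) (hC : ∀ t ∈ Icc s (s + h), ‖X' t - a‖ ≤ C) :
    ‖X (s + h) - X s - h • a‖ ≤ C * h := by
  have hd : ∀ t ∈ Icc s (s + h), HasDerivWithinAt (fun t => X t - t • a) (X' t - (1 : ℝ) • a)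
      (Icc s (s + h)) t := fun t _ =>
    ((hX t).sub ((hasDerivAt_id t).smul_const a)).hasDerivWithinAt
  have := (convex_Icc s (s + h)).norm_image_sub_le_of_norm_hasDerivWithin_le hd
    (C := C) (fun t ht => by simpa using hC t ht) (x := s) (y := s + h)
    (by simp [hh]) (by simp [hh])
  simp only [add_sub_cancel_left, Real.norm_of_nonneg hh] at this
  convert this using 2
  rw [add_smul]; abel

/-- The force frozen at time `s` costs `L * S * h ^ 2` in velocity. The position moves with the
updated velocity, hence is compared with `Y (s + h)` and costs a further `K * h ^ 2`. The assumption
`h ≤ 1` absorbs the higher powers. -/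
theorem eulerStep_error {F : E → E} {L : ℝ≥0} (hL : LipschitzWith L F) {K : ℝ}
    (hK : ∀ x, ‖F x‖ ≤ K) {X Y : ℝ → E} (hX : ∀ t, HasDerivAt X (Y t) t)
    (hY : ∀ t, HasDerivAt Y (F (X t)) t) {s h S : ℝ} (hh : 0 ≤ h) (hh1 : h ≤ 1)
    (hS : ∀ t ∈ Icc s (s + h), ‖Y t‖ ≤ S) (p : E × E) {e : ℝ}
    (he1 : ‖p.1 - X s‖ ≤ e) (he2 : ‖p.2 - Y s‖ ≤ e) :
    ‖(eulerStep F h p).1 - X (s + h)‖ ≤ (1 + (1 + L) * h) * e + (K + L * S) * h ^ 2 ∧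
    ‖(eulerStep F h p).2 - Y (s + h)‖ ≤ (1 + (1 + L) * h) * e + (K + L * S) * h ^ 2 := by
  have hK0 : 0 ≤ K := (norm_nonneg _).trans (hK 0)
  have hS0 : 0 ≤ S := (norm_nonneg _).trans (hS s ⟨le_rfl, by linarith⟩)
  have he0 : 0 ≤ e := (norm_nonneg _).trans he1
  have hL0 := L.coe_nonneg
  have hXd : ∀ t ∈ Icc s (s + h), ‖X t - X s‖ ≤ S * h := by
    intro t ht
    have := norm_sub_sub_smul_le (a := 0) (C := S) (s := s) (h := t - s) (by linarith [ht.1]) hX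
      (fun r hr => by simpa using hS r ⟨hr.1, by linarith [hr.2, ht.2]⟩)
    simp only [add_sub_cancel, smul_zero, sub_zero] at this
    exact this.trans (mul_le_mul_of_nonneg_left (by linarith [ht.2]) hS0)
  have hYd : ∀ t ∈ Icc s (s + h), ‖Y (s + h) - Y t‖ ≤ K * h := by
    intro t ht
    have := norm_sub_sub_smul_le (a := 0) (C := K) (s := t) (h := s + h - t)
      (by linarith [ht.2]) hY (fun r _ => by simpa using hK _)
    simp only [add_sub_cancel, smul_zero, sub_zero] at this
    exact this.trans (mul_le_mul_of_nonneg_left (by linarith [ht.1]) hK0)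
  have hY1 : ‖Y (s + h) - Y s - h • F (X s)‖ ≤ L * (S * h) * h :=
    norm_sub_sub_smul_le hh hY fun t ht => (hL.norm_sub_le _ _).trans
      (mul_le_mul_of_nonneg_left (hXd t ht) hL0)
  have hX1 : ‖X (s + h) - X s - h • Y (s + h)‖ ≤ K * h * h :=
    norm_sub_sub_smul_le hh hX fun t ht => by rw [norm_sub_rev]; exact hYd t ht
  have hF : ‖F p.1 - F (X s)‖ ≤ L * e :=
    (hL.norm_sub_le _ _).trans (mul_le_mul_of_nonneg_left he1 hL0)
  have h2 : ‖(eulerStep F h p).2 - Y (s + h)‖ ≤ e + h * (L * e) + L * (S * h) * h := by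
    have : (eulerStep F h p).2 - Y (s + h) = (p.2 - Y s) + h • (F p.1 - F (X s)) -
        (Y (s + h) - Y s - h • F (X s)) := by
      simp only [eulerStep, smul_sub]; abel
    rw [this]
    refine (norm_sub_le _ _).trans (add_le_add ((norm_add_le _ _).trans (add_le_add he2 ?_)) hY1)
    rw [norm_smul, Real.norm_of_nonneg hh]
    exact mul_le_mul_of_nonneg_left hF hh
  have h1 : ‖(eulerStep F h p).1 - X (s + h)‖ ≤
      e + h * (e + h * (L * e) + L * (S * h) * h) + K * h * h := by
    have : (eulerStep F h p).1 - X (s + h) = (p.1 - X s) + h • ((eulerStep F h p).2 - Y (s + h)) -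
        (X (s + h) - X s - h • Y (s + h)) := by
      simp only [eulerStep, smul_sub]; abel
    rw [this]
    refine (norm_sub_le _ _).trans (add_le_add ((norm_add_le _ _).trans (add_le_add he1 ?_)) hX1)
    rw [norm_smul, Real.norm_of_nonneg hh]
    exact mul_le_mul_of_nonneg_left h2 hh
  have a1 : 0 ≤ L * e := by positivity
  have a2 : 0 ≤ L * S := by positivity
  have a3 : h * (h * (L * e)) ≤ 1 * (h * (L * e)) :=
    mul_le_mul_of_nonneg_right hh1 (by positivity)
  have a4 : h * (L * (S * h) * h) ≤ 1 * (L * (S * h) * h) :=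
    mul_le_mul_of_nonneg_right hh1 (by positivity)
  have a5 : 0 ≤ K * h ^ 2 := by positivity
  have a6 : 0 ≤ h * e := by positivity
  constructor
  · refine h1.trans ?_
    nlinarith
  · refine h2.trans ?_
    nlinarith

/-- The symplectic Euler scheme converges to any exact solution. -/
theorem tendsto_eulerStep_iterate {F : E → E} {L : ℝ≥0} (hL : LipschitzWith L F) {K : ℝ}
    (hK : ∀ x, ‖F x‖ ≤ K) {X Y : ℝ → E} (hX : ∀ t, HasDerivAt X (Y t) t)
    (hY : ∀ t, HasDerivAt Y (F (X t)) t) {t : ℝ} (ht : 0 ≤ t) :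
    Filter.Tendsto (fun n : ℕ => (eulerStep F (t / n))^[n] (X 0, Y 0)) Filter.atTop
      (𝓝 (X t, Y t)) := by
  have hYc : Continuous Y := continuous_iff_continuousAt.2 fun t => (hY t).continuousAt
  obtain ⟨S, hS⟩ := (isCompact_Icc (a := (0 : ℝ)) (b := t)).exists_bound_of_continuousOn
    hYc.continuousOn
  have hK0 : 0 ≤ K := (norm_nonneg _).trans (hK 0)
  have hS0 : 0 ≤ S := (norm_nonneg _).trans (hS 0 ⟨le_rfl, ht⟩)
  have hL0 := L.coe_nonneg
  set A : ℝ := 1 + L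
  set B : ℝ := K + L * S
  have hA0 : 0 ≤ A := by positivity
  have hB0 : 0 ≤ B := by positivity
  -- Discrete Grönwall: `k` local errors of size `B * h ^ 2`, each amplified at most `k` times by `1
  -- + A * h`. At `k = n` the total is `O(1 / n)`.
  have main : ∀ n : ℕ, 0 < n → t / n ≤ 1 → ∀ k ≤ n,
      ‖((eulerStep F (t / n))^[k] (X 0, Y 0)).1 - X (k * (t / n))‖ ≤
        k * (B * (t / n) ^ 2) * (1 + A * (t / n)) ^ k ∧
      ‖((eulerStep F (t / n))^[k] (X 0, Y 0)).2 - Y (k * (t / n))‖ ≤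
        k * (B * (t / n) ^ 2) * (1 + A * (t / n)) ^ k := by
    intro n hn hn1 k
    set h := t / n with hh
    have hh0 : 0 ≤ h := by positivity
    have hnh : n * h = t := by rw [hh]; field_simp
    induction k with
    | zero => intro _; simp
    | succ k ih =>
      intro hk
      obtain ⟨i1, i2⟩ := ih (by omega)
      have hcast : ((k + 1 : ℕ) : ℝ) * h = k * h + h := by push_cast; ring
      have hkn : (k : ℝ) * h + h ≤ t := by
        rw [← hcast, ← hnh]
        exact mul_le_mul_of_nonneg_right (by exact_mod_cast hk) hh0
      have := eulerStep_error hL hK hX hY hh0 hn1 (s := k * h) (S := S)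
        (fun r hr => hS r ⟨le_trans (by positivity) hr.1, hr.2.trans hkn⟩) _ i1 i2
      rw [Function.iterate_succ_apply', hcast]
      have hb : (1 + A * h) * (k * (B * h ^ 2) * (1 + A * h) ^ k) + B * h ^ 2 ≤
          ((k + 1 : ℕ) : ℝ) * (B * h ^ 2) * (1 + A * h) ^ (k + 1) := by
        have h1 : 1 ≤ (1 + A * h) ^ (k + 1) := one_le_pow₀ (by nlinarith [mul_nonneg hA0 hh0])
        have h2 : B * h ^ 2 * 1 ≤ B * h ^ 2 * (1 + A * h) ^ (k + 1) :=
          mul_le_mul_of_nonneg_left h1 (by positivity)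
        have h3 : (1 + A * h) * (k * (B * h ^ 2) * (1 + A * h) ^ k) =
            k * (B * h ^ 2) * (1 + A * h) ^ (k + 1) := by ring
        push_cast
        linarith
      exact ⟨this.1.trans hb, this.2.trans hb⟩
  have hlim : Filter.Tendsto (fun n : ℕ => B * t ^ 2 * Real.exp (A * t) / n) Filter.atTop (𝓝 0) :=
    tendsto_const_div_atTop_nhds_zero_nat _
  have hev : ∀ᶠ n : ℕ in Filter.atTop,
      ‖(eulerStep F (t / n))^[n] (X 0, Y 0) - (X t, Y t)‖ ≤ B * t ^ 2 * Real.exp (A * t) / n := by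
    obtain ⟨n₀, hn₀⟩ := exists_nat_ge t
    filter_upwards [Filter.eventually_ge_atTop (max n₀ 1)] with n hn
    have hn1 : 1 ≤ n := (le_max_right _ _).trans hn
    have hn0 : (0 : ℝ) < n := by exact_mod_cast hn1
    have htn : t / n ≤ 1 := by
      rw [div_le_one hn0]
      exact hn₀.trans (by exact_mod_cast (le_max_left _ _).trans hn)
    have hnt : (n : ℝ) * (t / n) = t := by field_simp
    have hb : n * (B * (t / n) ^ 2) * (1 + A * (t / n)) ^ n ≤
        B * t ^ 2 * Real.exp (A * t) / n := by
      have h1 : (1 + A * (t / n)) ^ n ≤ Real.exp (A * t) := by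
        calc (1 + A * (t / n)) ^ n ≤ Real.exp (A * (t / n)) ^ n := by
              gcongr
              linarith [Real.add_one_le_exp (A * (t / n))]
          _ = Real.exp (A * t) := by
              rw [← Real.exp_nat_mul]; congr 1; rw [← hnt]; ring_nf; field_simp
      calc n * (B * (t / n) ^ 2) * (1 + A * (t / n)) ^ n
          ≤ n * (B * (t / n) ^ 2) * Real.exp (A * t) := by gcongr
        _ = B * t ^ 2 * Real.exp (A * t) / n := by field_simp
    obtain ⟨i1, i2⟩ := main n hn1 htn n le_rfl
    rw [hnt] at i1 i2
    exact max_le (i1.trans hb) (i2.trans hb)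
  rw [tendsto_iff_norm_sub_tendsto_zero]
  exact squeeze_zero' (Filter.Eventually.of_forall fun _ => norm_nonneg _) hev hlim

end Euler

/-! ### Regularity and parity of the force on the torus -/

section Potential

open scoped NNReal Topology

variable {d : ℕ}

theorem toTorus_add (a b : Vel d) : toTorus (a + b) = toTorus a + toTorus b := by
  ext i; simp [toTorus]

theorem toTorus_sub (a b : Vel d) : toTorus (a - b) = toTorus a - toTorus b := by
  ext i; simp [toTorus]

theorem toTorus_neg (a : Vel d) : toTorus (-a) = -toTorus a := by
  ext i; simp [toTorus]

theorem isOpenQuotientMap_toTorus : IsOpenQuotientMap (toTorus : Vel d → Torus d) := by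
  have h1 : IsOpenQuotientMap (Pi.map fun (_ : Fin d) (x : ℝ) => (x : UnitAddCircle)) :=
    IsOpenQuotientMap.piMap fun _ => QuotientAddGroup.isOpenQuotientMap_mk
  exact h1.comp (EuclideanSpace.equiv (Fin d) ℝ).toHomeomorph.isOpenQuotientMap

theorem continuous_toTorus : Continuous (toTorus : Vel d → Torus d) :=
  isOpenQuotientMap_toTorus.continuous

/-- A continuous function on `ℝ^d` that factors through the torus is bounded. -/
theorem exists_norm_le_of_periodic {F : Type*} [NormedAddCommGroup F] {g : Vel d → F}
    (hg : Continuous g) (hper : ∀ a b, toTorus a = toTorus b → g a = g b) :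
    ∃ C, ∀ y, ‖g y‖ ≤ C := by
  have hs := (isOpenQuotientMap_toTorus (d := d)).surjective
  set G : Torus d → F := fun x => g (hs x).choose with hG
  have hGg : G ∘ toTorus = g := by
    ext y
    exact hper _ _ (hs (toTorus y)).choose_spec
  have hGc : Continuous G :=
    isOpenQuotientMap_toTorus.isQuotientMap.continuous_iff.2 (hGg ▸ hg)
  obtain ⟨C, hC⟩ := isCompact_univ.exists_bound_of_continuousOn hGc.continuousOn
  exact ⟨C, fun y => by rw [← hGg]; exact hC _ (Set.mem_univ _)⟩

theorem grad_toTorus (V : Torus d → ℝ) (y : Vel d) :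
    grad V (toTorus y) = gradient (fun y => V (toTorus y)) y := by
  have : (fun y' : Vel d => V (toTorus y + toTorus y')) =
      fun y' => (fun y => V (toTorus y)) (y + y') := by
    ext y'; simp only [toTorus_add]
  rw [grad, this, gradient, gradient]
  refine congrArg _ ((fderiv_comp_add_left (f := fun y : Vel d => V (toTorus y)) y).trans ?_)
  rw [add_zero]

theorem IsPotential.continuous {V : Torus d → ℝ} (hV : IsPotential V) : Continuous V :=
  isOpenQuotientMap_toTorus.isQuotientMap.continuous_iff.2 hV.contDiff.continuous

theorem IsPotential.contDiff_grad {V : Torus d → ℝ} (hV : IsPotential V) :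
    ContDiff ℝ 2 (fun y : Vel d => grad V (toTorus y)) := by
  have h : (fun y : Vel d => grad V (toTorus y)) =
      fun y => (InnerProductSpace.toDual ℝ (Vel d)).symm
        (fderiv ℝ (fun y => V (toTorus y)) y) := by
    ext1 y; rw [grad_toTorus]; rfl
  rw [h]
  have h2 : ContDiff ℝ 2 (fderiv ℝ fun y : Vel d => V (toTorus y)) :=
    hV.contDiff.fderiv_right (by norm_num)
  exact (InnerProductSpace.toDual ℝ (Vel d)).symm.contDiff.comp h2

theorem IsPotential.continuous_grad {V : Torus d → ℝ} (hV : IsPotential V) :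
    Continuous (grad V) :=
  isOpenQuotientMap_toTorus.isQuotientMap.continuous_iff.2 hV.contDiff_grad.continuous

theorem IsPotential.exists_norm_grad_le {V : Torus d → ℝ} (hV : IsPotential V) :
    ∃ K, ∀ x, ‖grad V x‖ ≤ K := by
  obtain ⟨K, hK⟩ := isCompact_univ.exists_bound_of_continuousOn hV.continuous_grad.continuousOn
  exact ⟨K, fun x => hK x (Set.mem_univ x)⟩

/-- The derivative of the lifted gradient is continuous and factors through the compact torus, hence
is bounded. -/
theorem IsPotential.exists_lipschitzWith_grad {V : Torus d → ℝ} (hV : IsPotential V) :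
    ∃ L : ℝ≥0, LipschitzWith L (fun y : Vel d => grad V (toTorus y)) := by
  have hc : Continuous (fderiv ℝ fun y : Vel d => grad V (toTorus y)) :=
    hV.contDiff_grad.continuous_fderiv (by norm_num)
  obtain ⟨C, hC⟩ := exists_norm_le_of_periodic hc (by
    intro a b hab
    have h : ∀ c, fderiv ℝ (fun y : Vel d => grad V (toTorus y)) c =
        fderiv ℝ (fun y : Vel d => grad V (toTorus c + toTorus y)) 0 := by
      intro c
      have : (fun y : Vel d => grad V (toTorus c + toTorus y)) =
          fun y => (fun y : Vel d => grad V (toTorus y)) (c + y) := by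
        ext1 y; simp only [toTorus_add]
      rw [this]
      refine Eq.trans ?_
        (fderiv_comp_add_left (f := fun y : Vel d => grad V (toTorus y)) c).symm
      rw [add_zero]
    rw [h, h b, hab])
  have hC0 : 0 ≤ C := (norm_nonneg _).trans (hC 0)
  refine ⟨⟨C, hC0⟩, lipschitzWith_of_nnnorm_fderiv_le
    (hV.contDiff_grad.differentiable (by norm_num)) fun y => ?_⟩
  exact_mod_cast hC y

theorem IsPotential.hasFDerivAt {V : Torus d → ℝ} (hV : IsPotential V) (y : Vel d) :
    HasFDerivAt (fun y : Vel d => V (toTorus y)) (innerSL ℝ (grad V (toTorus y))) y := by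
  have h := ((hV.contDiff.differentiable (by norm_num)) y).hasGradientAt.hasFDerivAt
  rw [grad_toTorus]
  exact h

/-- Differentiating the evenness of `V` gives the law of action and reaction, on which energy
conservation rests. -/
theorem IsPotential.grad_neg {V : Torus d → ℝ} (hV : IsPotential V) (x : Torus d) :
    grad V (-x) = -grad V x := by
  obtain ⟨y, rfl⟩ := isOpenQuotientMap_toTorus.surjective x
  have h1 := hV.hasFDerivAt (-y)
  have h2 : HasFDerivAt (fun y : Vel d => V (toTorus y))
      ((innerSL ℝ (grad V (toTorus (-y)))).comp (-(ContinuousLinearMap.id ℝ (Vel d)))) y := by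
    have h3 := h1.comp y (hasFDerivAt_id y).neg
    refine h3.congr_of_eventuallyEq (Filter.Eventually.of_forall fun w => ?_)
    simp [toTorus_neg, hV.even]
  have h4 := h2.unique (hV.hasFDerivAt y)
  rw [← toTorus_neg]
  refine ext_inner_right ℝ fun w => ?_
  have h5 := congrArg (fun f : Vel d →L[ℝ] ℝ => f w) h4
  simp only [ContinuousLinearMap.comp_apply, innerSL_apply_apply, neg_apply,
    ContinuousLinearMap.id_apply, inner_neg_right] at h5
  rw [inner_neg_left, ← h5, neg_neg]

end Potential

/-! ### The Newton flow as a limit of Euler schemes on the torus -/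

section Newton

open scoped NNReal Topology

variable {d N : ℕ}

/-- The forces in a configuration of `N + 1` particles. -/
noncomputable def force (V : Torus d → ℝ) (x : Fin (N + 1) → Torus d) (j : Fin (N + 1)) : Vel d :=
  -(1 / (N : ℝ)) • ∑ l ∈ Finset.univ.erase j, grad V (x j - x l)

/-- The forces, on the universal cover. -/
noncomputable def liftedForce (V : Torus d → ℝ) (x : Fin (N + 1) → Vel d) :
    Fin (N + 1) → Vel d :=
  force V fun j => toTorus (x j)

theorem liftedForce_apply (V : Torus d → ℝ) (x : Fin (N + 1) → Vel d) (j : Fin (N + 1)) :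
    liftedForce V x j =
      -(1 / (N : ℝ)) • ∑ l ∈ Finset.univ.erase j, grad V (toTorus (x j - x l)) := by
  simp only [liftedForce, force, toTorus_sub]

theorem continuous_force {V : Torus d → ℝ} (hV : IsPotential V) :
    Continuous (force V : (Fin (N + 1) → Torus d) → Fin (N + 1) → Vel d) := by
  refine continuous_pi fun j => ?_
  have h : Continuous fun x : Fin (N + 1) → Torus d =>
      ∑ l ∈ Finset.univ.erase j, grad V (x j - x l) :=
    continuous_finsetSum _ fun l _ => hV.continuous_grad.comp (by fun_prop)
  exact h.const_smul (-(1 / (N : ℝ)))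

theorem contDiff_liftedForce {V : Torus d → ℝ} (hV : IsPotential V) :
    ContDiff ℝ 1 (liftedForce V : (Fin (N + 1) → Vel d) → Fin (N + 1) → Vel d) := by
  refine contDiff_pi.2 fun j => ?_
  simp only [liftedForce_apply]
  refine ContDiff.const_smul _ (ContDiff.sum fun l _ => ?_)
  have h : ContDiff ℝ 1 fun x : Fin (N + 1) → Vel d => x j - x l :=
    (contDiff_apply ℝ (Vel d) j).sub (contDiff_apply ℝ (Vel d) l)
  exact (hV.contDiff_grad.of_le (by norm_num)).comp h

theorem exists_norm_liftedForce_le {V : Torus d → ℝ} (hV : IsPotential V) :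
    ∃ K, ∀ x : Fin (N + 1) → Vel d, ‖liftedForce V x‖ ≤ K := by
  obtain ⟨K, hK⟩ := hV.exists_norm_grad_le
  have hK0 : 0 ≤ K := (norm_nonneg _).trans (hK 0)
  refine ⟨1 / (N : ℝ) * ((N + 1 : ℕ) * K), fun x => (pi_norm_le_iff_of_nonneg (by positivity)).2
    fun j => ?_⟩
  rw [liftedForce_apply, norm_smul, norm_neg, Real.norm_of_nonneg (by positivity)]
  refine mul_le_mul_of_nonneg_left ((norm_sum_le_of_le _ fun l _ => hK _).trans ?_) (by positivity)
  rw [Finset.sum_const, nsmul_eq_mul]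
  refine mul_le_mul_of_nonneg_right ?_ hK0
  exact_mod_cast (Finset.card_le_univ _).trans (by simp)

theorem exists_lipschitzWith_liftedForce {V : Torus d → ℝ} (hV : IsPotential V) :
    ∃ L : ℝ≥0, LipschitzWith L
      (liftedForce V : (Fin (N + 1) → Vel d) → Fin (N + 1) → Vel d) := by
  obtain ⟨L, hL⟩ := hV.exists_lipschitzWith_grad
  refine ⟨_, LipschitzWith.of_dist_le' (K := 1 / (N : ℝ) * ((N + 1 : ℕ) * (L * 2)))
    fun x y => ?_⟩
  rw [dist_eq_norm, dist_eq_norm]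
  refine (pi_norm_le_iff_of_nonneg (by positivity)).2 fun j => ?_
  rw [Pi.sub_apply, liftedForce_apply, liftedForce_apply, ← smul_sub, ← Finset.sum_sub_distrib,
    norm_smul, norm_neg, Real.norm_of_nonneg (by positivity), mul_assoc, mul_assoc]
  refine mul_le_mul_of_nonneg_left ?_ (by positivity)
  have hl : ∀ l ∈ Finset.univ.erase j,
      ‖grad V (toTorus (x j - x l)) - grad V (toTorus (y j - y l))‖ ≤ L * 2 * ‖x - y‖ := by
    intro l _
    refine (hL.norm_sub_le _ _).trans ?_
    rw [mul_assoc]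
    refine mul_le_mul_of_nonneg_left ?_ L.coe_nonneg
    have h1 : x j - x l - (y j - y l) = (x - y) j - (x - y) l := by
      simp only [Pi.sub_apply]; abel
    rw [h1]
    refine (norm_sub_le _ _).trans ?_
    linarith [norm_le_pi_norm (x - y) j, norm_le_pi_norm (x - y) l]
  refine (norm_sum_le_of_le _ hl).trans ?_
  rw [Finset.sum_const, nsmul_eq_mul]
  refine mul_le_mul_of_nonneg_right ?_ (by positivity)
  exact_mod_cast (Finset.card_le_univ _).trans (by simp)

theorem exists_isNewtonTrajectory {V : Torus d → ℝ} (hV : IsPotential V)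
    (z : Fin (N + 1) → Phase d) : ∃ γ, IsNewtonTrajectory V γ ∧ γ 0 = z := by
  obtain ⟨L, hL⟩ := exists_lipschitzWith_liftedForce (N := N) hV
  choose x hx using fun j => (isOpenQuotientMap_toTorus (d := d)).surjective (z j).1
  obtain ⟨X, Y, hX0, hY0, hXY⟩ := exists_global_newton_solution hL (contDiff_liftedForce hV) x
    fun j => (z j).2
  refine ⟨fun t j => (toTorus (X t j), Y t j), ⟨fun j t => X t j, fun j t => ⟨rfl, ?_, ?_⟩⟩, ?_⟩
  · exact hasDerivAt_pi.1 (hXY t).1 j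
  · exact hasDerivAt_pi.1 (hXY t).2 j
  · ext1 j
    exact Prod.ext (by simp [hX0, hx]) (by simp [hY0])

/-- The choice made in `newtonFlow` does not involve `t`, so one trajectory serves all times. -/
theorem exists_newtonFlow_eq {V : Torus d → ℝ} (hV : IsPotential V)
    (z : Fin (N + 1) → Phase d) :
    ∃ γ, IsNewtonTrajectory V γ ∧ γ 0 = z ∧ ∀ t, newtonFlow V t z = γ t := by
  have h := exists_isNewtonTrajectory hV z
  exact ⟨h.choose, h.choose_spec.1, h.choose_spec.2, fun t => by rw [newtonFlow, dif_pos h]⟩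

/-- The kick of the symplectic Euler scheme on the torus. -/
noncomputable def kick (V : Torus d → ℝ) (h : ℝ) (z : Fin (N + 1) → Phase d) :
    Fin (N + 1) → Phase d :=
  fun j => ((z j).1, (z j).2 + h • force V (fun i => (z i).1) j)

/-- The free transport of the symplectic Euler scheme on the torus. -/
noncomputable def drift (h : ℝ) (z : Fin (N + 1) → Phase d) : Fin (N + 1) → Phase d :=
  fun j => ((z j).1 + toTorus (h • (z j).2), (z j).2)

/-- One step of the symplectic Euler scheme on the torus. -/
noncomputable def torusEuler (V : Torus d → ℝ) (h : ℝ) (z : Fin (N + 1) → Phase d) :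
    Fin (N + 1) → Phase d :=
  drift h (kick V h z)

/-- The covering map intertwines the schemes on `ℝ^d` and on the torus and is continuous, so
convergence descends. The measure and symmetry properties of the flow are obtained by passing to
this limit. -/
theorem tendsto_torusEuler_iterate {V : Torus d → ℝ} (hV : IsPotential V)
    (z : Fin (N + 1) → Phase d) {t : ℝ} (ht : 0 ≤ t) :
    Filter.Tendsto (fun n : ℕ => (torusEuler V (t / n))^[n] z) Filter.atTop
      (𝓝 (newtonFlow V t z)) := by
  obtain ⟨γ, ⟨X, hX⟩, hγ0, hγ⟩ := exists_newtonFlow_eq hV z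
  obtain ⟨L, hL⟩ := exists_lipschitzWith_liftedForce (N := N) hV
  obtain ⟨K, hK⟩ := exists_norm_liftedForce_le (N := N) hV
  set P : (Fin (N + 1) → Vel d) × (Fin (N + 1) → Vel d) → Fin (N + 1) → Phase d :=
    fun p j => (toTorus (p.1 j), p.2 j) with hP
  have hPc : Continuous P := continuous_pi fun j =>
    (continuous_toTorus.comp ((continuous_apply j).comp continuous_fst)).prodMk
      ((continuous_apply j).comp continuous_snd)
  have hsemi : ∀ h, Function.Semiconj P (eulerStep (liftedForce V) h) (torusEuler V h) := by
    intro h p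
    ext1 j
    simp only [hP, torusEuler, drift, kick, eulerStep, Pi.add_apply, Pi.smul_apply, toTorus_add]
    rfl
  have hγP : ∀ s, γ s = P (fun j => X j s, fun j => (γ s j).2) := by
    intro s; ext1 j; exact Prod.ext (hX j s).1 rfl
  have hlim := tendsto_eulerStep_iterate hL hK (X := fun s j => X j s)
    (Y := fun s j => (γ s j).2) (fun s => hasDerivAt_pi.2 fun j => (hX j s).2.1)
    (fun s => hasDerivAt_pi.2 fun j => by
      have h := (hX j s).2.2
      simp only [fun l => (hX l s).1] at h
      exact h) ht
  have h2 := (hPc.tendsto _).comp hlim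
  rw [hγ, hγP]
  refine h2.congr fun n => ?_
  rw [Function.comp_apply, ((hsemi _).iterate_right n).eq, ← hγP, hγ0]

theorem torusEuler_comp_perm (V : Torus d → ℝ) (h : ℝ) (z : Fin (N + 1) → Phase d)
    (π : Equiv.Perm (Fin (N + 1))) :
    torusEuler V h (z ∘ π) = torusEuler V h z ∘ π := by
  have hF : ∀ j, force V (fun i => (z (π i)).1) j = force V (fun i => (z i).1) (π j) := by
    intro j
    simp only [force]
    rw [Finset.sum_erase_eq_sub (Finset.mem_univ _), Finset.sum_erase_eq_sub (Finset.mem_univ _),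
      Equiv.sum_comp π fun l => grad V ((z (π j)).1 - (z l).1)]
  ext1 j
  simp only [torusEuler, drift, kick, Function.comp_apply, hF]

/-- Equivariance is exact at each Euler step and survives the limit, so uniqueness of trajectories
need not be invoked. -/
theorem newtonFlow_comp_perm {V : Torus d → ℝ} (hV : IsPotential V)
    (z : Fin (N + 1) → Phase d) {t : ℝ} (ht : 0 ≤ t) (π : Equiv.Perm (Fin (N + 1))) :
    newtonFlow V t (z ∘ π) = newtonFlow V t z ∘ π := by
  have h1 := tendsto_torusEuler_iterate hV (z ∘ π) ht
  have hc : Continuous fun w : Fin (N + 1) → Phase d => w ∘ π :=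
    continuous_pi fun j => continuous_apply (π j)
  have h2 := (hc.tendsto _).comp (tendsto_torusEuler_iterate hV z ht)
  refine tendsto_nhds_unique h1 (h2.congr fun n => ?_)
  have hs : Function.Semiconj (fun w : Fin (N + 1) → Phase d => w ∘ π)
    (torusEuler V (t / n)) (torusEuler V (t / n)) := fun w => (torusEuler_comp_perm V _ w π).symm
  exact (hs.iterate_right n).eq z

end Newton

/-! ### Half of Liouville's theorem -/

section Liouville

open Filter
open scoped Topology ENNReal

instance instBorelSpacePhase (d : ℕ) : BorelSpace (Phase d) := inferInstance

instance instSigmaFinitePhase (d : ℕ) : SigmaFinite (volume : Measure (Phase d)) := inferInstance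

instance instIsLocallyFiniteMeasurePhase (d : ℕ) :
    IsLocallyFiniteMeasure (volume : Measure (Phase d)) :=
  inferInstanceAs
    (IsLocallyFiniteMeasure ((volume : Measure (Torus d)).prod (volume : Measure (Vel d))))

/-- A pointwise limit of maps that preserve an outer regular measure does not increase it. -/
theorem map_le_of_tendsto_measurePreserving {X : Type*} [TopologicalSpace X]
    [MeasurableSpace X] [BorelSpace X] {μ : Measure X} [μ.OuterRegular]
    {Φ : X → X} (hΦ : Measurable Φ) {Ψ : ℕ → X → X} (hΨ : ∀ n, MeasurePreserving (Ψ n) μ μ)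
    (hlim : ∀ x, Tendsto (fun n => Ψ n x) atTop (𝓝 (Φ x))) : Measure.map Φ μ ≤ μ := by
  -- The indicator of an open set is lower semicontinuous, so Fatou's lemma applies; outer
  -- regularity then reaches all measurable sets.
  have hopen : ∀ U : Set X, IsOpen U → Measure.map Φ μ U ≤ μ U := by
    intro U hU
    have h1 : ∀ x, U.indicator (1 : X → ℝ≥0∞) (Φ x) ≤
        liminf (fun n => U.indicator (1 : X → ℝ≥0∞) (Ψ n x)) atTop := by
      intro x
      by_cases hx : Φ x ∈ U
      · have hev : ∀ᶠ n in atTop, U.indicator (1 : X → ℝ≥0∞) (Ψ n x) = 1 :=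
          ((hlim x).eventually (hU.mem_nhds hx)).mono fun n hn => Set.indicator_of_mem hn _
        rw [liminf_congr hev]
        simp [hx]
      · simp [hx]
    have hm : Measurable (U.indicator (1 : X → ℝ≥0∞)) :=
      measurable_one.indicator hU.measurableSet
    calc Measure.map Φ μ U = ∫⁻ x, U.indicator (1 : X → ℝ≥0∞) (Φ x) ∂μ := by
          rw [← lintegral_map hm hΦ, lintegral_indicator_one hU.measurableSet]
      _ ≤ ∫⁻ x, liminf (fun n => U.indicator (1 : X → ℝ≥0∞) (Ψ n x)) atTop ∂μ :=
          lintegral_mono h1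
      _ ≤ liminf (fun n => ∫⁻ x, U.indicator (1 : X → ℝ≥0∞) (Ψ n x) ∂μ) atTop :=
          lintegral_liminf_le fun n => hm.comp (hΨ n).measurable
      _ = μ U := by
          have : ∀ n, ∫⁻ x, U.indicator (1 : X → ℝ≥0∞) (Ψ n x) ∂μ = μ U := fun n => by
            rw [(hΨ n).lintegral_comp hm, lintegral_indicator_one hU.measurableSet]
          simp [this]
  refine Measure.le_iff.2 fun s _ => ?_
  rw [s.measure_eq_iInf_isOpen μ]
  exact le_iInf fun U => le_iInf fun hsU => le_iInf fun hU =>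
    (measure_mono hsU).trans (hopen U hU)

variable {d N : ℕ}

/-- With positions and velocities regrouped, the kick is a shear: it translates velocities by a
function of the positions alone. -/
theorem measurePreserving_kick {V : Torus d → ℝ} (hV : IsPotential V) (h : ℝ) :
    MeasurePreserving (kick (N := N) V h) volume volume := by
  set e := MeasurableEquiv.arrowProdEquivProdArrow (Torus d) (Vel d) (Fin (N + 1)) with he
  have hep : MeasurePreserving e volume volume :=
    volume_measurePreserving_arrowProdEquivProdArrow (Torus d) (Vel d) (Fin (N + 1))
  have hF : Measurable (force V : (Fin (N + 1) → Torus d) → Fin (N + 1) → Vel d) :=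
    (continuous_force hV).measurable
  have hg : Measurable (Function.uncurry fun (x : Fin (N + 1) → Torus d)
      (v : Fin (N + 1) → Vel d) => v + h • force V x) :=
    measurable_snd.add ((hF.comp measurable_fst).const_smul h)
  have hs : MeasurePreserving (fun p : (Fin (N + 1) → Torus d) × (Fin (N + 1) → Vel d) =>
      (id p.1, p.2 + h • force V p.1)) (volume.prod volume) (volume.prod volume) :=
    (MeasurePreserving.id _).skew_product hg (ae_of_all _ fun x =>
      (measurePreserving_add_right volume (h • force V x)).map_eq)
  exact (hep.symm.comp hs).comp hep

/-- A shear in each particle separately; the swap puts the unchanged velocity first. -/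
theorem measurePreserving_drift (h : ℝ) :
    MeasurePreserving (drift (d := d) (N := N) h) volume volume := by
  refine volume_preserving_pi (f := fun _ (p : Phase d) => (p.1 + toTorus (h • p.2), p.2))
    fun _ => ?_
  have hg : Measurable (Function.uncurry fun (v : Vel d) (x : Torus d) =>
      x + toTorus (h • v)) :=
    measurable_snd.add (continuous_toTorus.measurable.comp (measurable_fst.const_smul h))
  have hs : MeasurePreserving (fun p : Vel d × Torus d => (id p.1, p.2 + toTorus (h • p.1)))
      (volume.prod volume) (volume.prod volume) :=
    (MeasurePreserving.id _).skew_product hg (ae_of_all _ fun v =>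
      (measurePreserving_add_right volume (toTorus (h • v))).map_eq)
  exact (Measure.measurePreserving_swap.comp hs).comp Measure.measurePreserving_swap

theorem measurePreserving_torusEuler {V : Torus d → ℝ} (hV : IsPotential V) (h : ℝ) :
    MeasurePreserving (torusEuler (N := N) V h) volume volume :=
  (measurePreserving_drift h).comp (measurePreserving_kick hV h)

theorem measurable_newtonFlow {V : Torus d → ℝ} (hV : IsPotential V) {t : ℝ} (ht : 0 ≤ t) :
    Measurable (newtonFlow (N := N) V t) :=
  measurable_of_tendsto_metrizable
    (fun n : ℕ => ((measurePreserving_torusEuler hV (t / n)).iterate n).measurable)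
    (tendsto_pi_nhds.2 fun z => tendsto_torusEuler_iterate hV z ht)

/-- The Newton flow does not increase Lebesgue measure (half of Liouville's theorem). -/
theorem map_newtonFlow_le {V : Torus d → ℝ} (hV : IsPotential V) {t : ℝ} (ht : 0 ≤ t) :
    Measure.map (newtonFlow (N := N) V t) volume ≤ volume :=
  map_le_of_tendsto_measurePreserving (measurable_newtonFlow hV ht)
    (fun n : ℕ => (measurePreserving_torusEuler hV (t / n)).iterate n)
    fun z => tendsto_torusEuler_iterate hV z ht

end Liouville

/-! ### Conservation of energy -/

section Energy

variable {d N : ℕ}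

/-- The interaction energy, with coupling `1/N`, of a family of particles. -/
noncomputable def interaction (N : ℕ) {ι : Type*} [Fintype ι] [DecidableEq ι] (V : Torus d → ℝ)
    (z : ι → Phase d) : ℝ :=
  1 / (2 * (N : ℝ)) * ∑ j, ∑ l ∈ Finset.univ.erase j, V ((z j).1 - (z l).1)

/-- The kinetic energy. -/
noncomputable def kinetic {ι : Type*} [Fintype ι] (z : ι → Phase d) : ℝ :=
  1 / 2 * ∑ j, ‖(z j).2‖ ^ 2

/-- The power of the forces cancels the derivative of the interaction energy because the pair forces
are antisymmetric. -/
theorem IsNewtonTrajectory.energy_eq {V : Torus d → ℝ} (hV : IsPotential V)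
    {γ : ℝ → Fin (N + 1) → Phase d} (hγ : IsNewtonTrajectory V γ) (t : ℝ) :
    kinetic (γ t) + interaction N V (γ t) = kinetic (γ 0) + interaction N V (γ 0) := by
  obtain ⟨X, hX⟩ := hγ
  have hd : ∀ s, HasDerivAt (fun s => kinetic (γ s) + interaction N V (γ s)) 0 s := by
    intro s
    set v : Fin (N + 1) → Vel d := fun j => (γ s j).2 with hv
    set g : Fin (N + 1) → Fin (N + 1) → Vel d := fun j l => grad V ((γ s j).1 - (γ s l).1) with hg
    have hgs : ∀ j l, g l j = -g j l := by
      intro j l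
      simp only [hg]
      rw [← hV.grad_neg, neg_sub]
    have hk : HasDerivAt (fun s => kinetic (γ s))
        (1 / 2 * ∑ j, 2 * inner ℝ (v j)
          (-(1 / (N : ℝ)) • ∑ l ∈ Finset.univ.erase j, g j l)) s := by
      refine HasDerivAt.const_mul _ (HasDerivAt.fun_sum fun j _ => ?_)
      exact (hX j s).2.2.norm_sq
    have hi : HasDerivAt (fun s => interaction N V (γ s))
        (1 / (2 * (N : ℝ)) * ∑ j, ∑ l ∈ Finset.univ.erase j, inner ℝ (g j l) (v j - v l)) s := by
      refine HasDerivAt.const_mul _ (HasDerivAt.fun_sum fun j _ => HasDerivAt.fun_sum fun l _ => ?_)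
      have h1 : HasDerivAt (fun s => X j s - X l s) (v j - v l) s :=
        (hX j s).2.1.sub (hX l s).2.1
      have h2 := (hV.hasFDerivAt (X j s - X l s)).comp_hasDerivAt s h1
      have h3 : grad V (toTorus (X j s - X l s)) = g j l := by
        rw [toTorus_sub, ← (hX j s).1, ← (hX l s).1]
      rw [h3] at h2
      refine h2.congr_of_eventuallyEq (Filter.Eventually.of_forall fun r => ?_)
      simp only [Function.comp_apply, toTorus_sub, (hX _ r).1]
    have hz : 1 / 2 * ∑ j, 2 * inner ℝ (v j)
          (-(1 / (N : ℝ)) • ∑ l ∈ Finset.univ.erase j, g j l) +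
        1 / (2 * (N : ℝ)) * ∑ j, ∑ l ∈ Finset.univ.erase j, inner ℝ (g j l) (v j - v l) = 0 := by
      have e1 : ∀ j, ∑ l ∈ Finset.univ.erase j, inner ℝ (g j l) (v j - v l) =
          ∑ l, inner ℝ (g j l) (v j - v l) := fun j => Finset.sum_erase _ (by simp)
      -- Antisymmetry kills the diagonal, so the sums may run over all pairs and be reindexed by
      -- exchanging `j` and `l`.
      have hgz : ∀ j, g j j = 0 := fun j => by
        have h : (2 : ℝ) • g j j = 0 := by
          rw [two_smul]; nth_rewrite 1 [hgs j j]; exact neg_add_cancel _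
        simpa using h
      have e2 : ∀ j, ∑ l ∈ Finset.univ.erase j, g j l = ∑ l, g j l :=
        fun j => Finset.sum_erase _ (hgz j)
      have e3 : ∑ j, ∑ l, inner ℝ (g j l) (v l) = -∑ j, ∑ l, inner ℝ (g j l) (v j) := by
        rw [Finset.sum_comm, ← Finset.sum_neg_distrib]
        refine Finset.sum_congr rfl fun j _ => ?_
        rw [← Finset.sum_neg_distrib]
        exact Finset.sum_congr rfl fun l _ => by rw [hgs j l, inner_neg_left]
      rw [Finset.sum_congr rfl fun j _ => e1 j]
      simp only [e2, inner_smul_right, inner_sum, inner_sub_right, Finset.sum_sub_distrib, e3,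
        ← Finset.mul_sum]
      have e4 : ∑ j, ∑ l, inner ℝ (v j) (g j l) = ∑ j, ∑ l, inner ℝ (g j l) (v j) :=
        Finset.sum_congr rfl fun j _ => Finset.sum_congr rfl fun l _ => real_inner_comm _ _
      rcases Nat.eq_zero_or_pos N with hN | hN
      · simp [hN]
      · have : (N : ℝ) ≠ 0 := by positivity
        rw [e4]
        field_simp
        ring
    have := hk.add hi
    rw [hz] at this
    exact this
  exact is_const_of_deriv_eq_zero (fun s => (hd s).differentiableAt) (fun s => (hd s).deriv) t 0

theorem energy_newtonFlow {V : Torus d → ℝ} (hV : IsPotential V) (z : Fin (N + 1) → Phase d)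
    (t : ℝ) : kinetic (newtonFlow V t z) + interaction N V (newtonFlow V t z) =
      kinetic z + interaction N V z := by
  obtain ⟨γ, hγ, hγ0, h⟩ := exists_newtonFlow_eq hV z
  rw [h, hγ.energy_eq hV, hγ0]

end Energy

/-! ### Contraction of weighted norms under transport -/

section Transport

open Filter
open scoped Topology ENNReal

/-- Young's inequality, from `(a - F * w) ^ 2 * w⁻¹ ≥ 0`. -/
theorem two_mul_mul_le_sq_mul_inv_add (a F w : ℝ≥0∞) (hw0 : w ≠ 0) (hw : w ≠ ∞) (ha : a ≠ ∞) :
    2 * (a * F) ≤ a ^ 2 * w⁻¹ + F ^ 2 * w := by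
  rcases eq_or_ne F ∞ with rfl | hF
  · simp [ENNReal.top_mul hw0]
  have hw' : 0 < w.toReal := ENNReal.toReal_pos hw0 hw
  rw [← ENNReal.toReal_le_toReal (by finiteness) (by
    have := ENNReal.inv_ne_top.2 hw0
    finiteness), ENNReal.toReal_add (by
    have := ENNReal.inv_ne_top.2 hw0
    finiteness) (by finiteness)]
  simp only [ENNReal.toReal_mul, ENNReal.toReal_pow, ENNReal.toReal_inv, ENNReal.toReal_ofNat]
  have h : a.toReal ^ 2 * w.toReal⁻¹ + F.toReal ^ 2 * w.toReal - 2 * (a.toReal * F.toReal) =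
      (a.toReal - F.toReal * w.toReal) ^ 2 * w.toReal⁻¹ := by
    field_simp; ring
  have h2 : 0 ≤ (a.toReal - F.toReal * w.toReal) ^ 2 * w.toReal⁻¹ := by positivity
  linarith

/-- Transport of a density by a map that does not increase the reference measure contracts the
`L²` norm with any invariant weight. -/
theorem lintegral_sq_mul_le_of_map_le {X : Type*} [MeasurableSpace X] {μ : Measure X}
    {Φ : X → X} (hΦ : Measurable Φ) (hle : Measure.map Φ μ ≤ μ) {w : X → ℝ≥0∞}
    (hw : Measurable w) (hw0 : ∀ x, w x ≠ 0) (hwt : ∀ x, w x ≠ ∞) (hinv : ∀ x, w (Φ x) = w x)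
    (hfin : ∫⁻ x, (w x)⁻¹ ∂μ ≠ ∞) {F g : X → ℝ≥0∞} (hF : Measurable F) (hg : Measurable g)
    (hgF : μ.withDensity g ≤ Measure.map Φ (μ.withDensity F)) :
    ∫⁻ x, g x ^ 2 * w x ∂μ ≤ ∫⁻ x, F x ^ 2 * w x ∂μ := by
  set B := ∫⁻ x, F x ^ 2 * w x ∂μ with hB
  -- The norm of `g` is tested by duality against `g * w`. Truncation at `n`, together with
  -- integrability of `w⁻¹`, makes `A` below finite, so that `A` can be cancelled from `2 * A ≤ A +
  -- B`.
  set ψ : ℕ → X → ℝ≥0∞ := fun n x => min (g x * w x) n with hψ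
  have hψm : ∀ n, Measurable (ψ n) := fun n => (hg.mul hw).min measurable_const
  have hwinv : Measurable fun x => (w x)⁻¹ := hw.inv
  have hψw : ∀ n, Measurable fun x => ψ n x ^ 2 * (w x)⁻¹ := fun n => ((hψm n).pow_const 2).mul hwinv
  have hψt : ∀ n x, ψ n x ≠ ∞ := fun n x =>
    ((min_le_right _ _).trans_lt (ENNReal.natCast_lt_top n)).ne
  have key : ∀ n, ∫⁻ x, ψ n x ^ 2 * (w x)⁻¹ ∂μ ≤ B := by
    intro n
    set A := ∫⁻ x, ψ n x ^ 2 * (w x)⁻¹ ∂μ with hA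
    have hAt : A ≠ ∞ := by
      refine ne_top_of_le_ne_top (ENNReal.mul_ne_top (b := ∫⁻ x, (w x)⁻¹ ∂μ)
        (a := (n : ℝ≥0∞) ^ 2) (by finiteness) hfin) ?_
      rw [hA, ← lintegral_const_mul _ hwinv]
      refine lintegral_mono fun x => ?_
      gcongr
      exact min_le_right _ _
    have h1 : A ≤ ∫⁻ x, ψ n x ∂(μ.withDensity g) := by
      rw [lintegral_withDensity_eq_lintegral_mul _ hg (hψm n)]
      refine lintegral_mono fun x => ?_
      have h : ψ n x * (w x)⁻¹ ≤ g x := by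
        rw [← div_eq_mul_inv]
        exact ENNReal.div_le_of_le_mul (min_le_left _ _)
      calc ψ n x ^ 2 * (w x)⁻¹ = (ψ n x * (w x)⁻¹) * ψ n x := by ring
        _ ≤ g x * ψ n x := by gcongr
    have h2 : ∫⁻ x, ψ n x ∂(μ.withDensity g) ≤ ∫⁻ x, ψ n (Φ x) * F x ∂μ := by
      refine (lintegral_mono' hgF le_rfl).trans ?_
      rw [lintegral_map (hψm n) hΦ,
        lintegral_withDensity_eq_lintegral_mul _ hF
          (show Measurable fun x => ψ n (Φ x) from (hψm n).comp hΦ)]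
      exact lintegral_mono fun x => by simp only [Pi.mul_apply]; rw [mul_comm]
    -- Invariance of `w` makes the integrand a function of `Φ x`, and the one-sided bound on
    -- `Measure.map Φ μ` suffices.
    have h3 : ∫⁻ x, ψ n (Φ x) ^ 2 * (w x)⁻¹ ∂μ ≤ A := by
      have : ∀ x, ψ n (Φ x) ^ 2 * (w x)⁻¹ = (fun y => ψ n y ^ 2 * (w y)⁻¹) (Φ x) :=
        fun x => by simp only [hinv]
      simp_rw [this]
      rw [← lintegral_map (hψw n) hΦ]
      exact lintegral_mono' hle le_rfl
    have h4 : 2 * A ≤ A + B := by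
      calc 2 * A ≤ 2 * ∫⁻ x, ψ n (Φ x) * F x ∂μ := by gcongr; exact h1.trans h2
        _ = ∫⁻ x, 2 * (ψ n (Φ x) * F x) ∂μ :=
            (lintegral_const_mul _ (((hψm n).comp hΦ).mul hF)).symm
        _ ≤ ∫⁻ x, (ψ n (Φ x) ^ 2 * (w x)⁻¹ + F x ^ 2 * w x) ∂μ :=
            lintegral_mono fun x =>
              two_mul_mul_le_sq_mul_inv_add _ _ _ (hw0 x) (hwt x) (hψt n _)
        _ = ∫⁻ x, ψ n (Φ x) ^ 2 * (w x)⁻¹ ∂μ + B :=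
            lintegral_add_right _ ((hF.pow_const 2).mul hw)
        _ ≤ A + B := by gcongr
    rw [two_mul] at h4
    exact (ENNReal.add_le_add_iff_left hAt).1 h4
  have hlim : ∀ x, Tendsto (fun n => ψ n x ^ 2 * (w x)⁻¹) atTop (𝓝 (g x ^ 2 * w x)) := by
    intro x
    have h1 : Tendsto (fun n => ψ n x) atTop (𝓝 (g x * w x)) := by
      have h := (tendsto_const_nhds (x := g x * w x)).min ENNReal.tendsto_nat_nhds_top
      simpa using h
    have h2 : g x ^ 2 * w x = (g x * w x) ^ 2 * (w x)⁻¹ := by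
      rw [mul_pow, mul_assoc, pow_two (w x), mul_assoc, ENNReal.mul_inv_cancel (hw0 x) (hwt x),
        mul_one]
    rw [h2]
    exact ENNReal.Tendsto.mul_const (((ENNReal.continuous_pow 2).tendsto _).comp h1) (Or.inr (ENNReal.inv_ne_top.2 (hw0 x)))
  calc ∫⁻ x, g x ^ 2 * w x ∂μ = ∫⁻ x, liminf (fun n => ψ n x ^ 2 * (w x)⁻¹) atTop ∂μ :=
        lintegral_congr fun x => (hlim x).liminf_eq.symm
    _ ≤ liminf (fun n => ∫⁻ x, ψ n x ^ 2 * (w x)⁻¹ ∂μ) atTop := lintegral_liminf_le hψw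
    _ ≤ B := by
        refine liminf_le_of_le (by isBoundedDefault) fun b hb => ?_
        obtain ⟨n, hn⟩ := hb.exists
        exact hn.trans (key n)

end Transport

/-! ### Orthogonality in the Hoeffding decomposition -/

section Anova

variable {H : Type*} [NormedAddCommGroup H] [InnerProductSpace ℝ H]
variable {I : Type*} [DecidableEq I]

/-- The alternating sums of a family of vectors indexed by finite sets. -/
def alternatingSum (A : Finset I → H) (σ : Finset I) : H :=
  ∑ ρ ∈ σ.powerset, (-1 : ℝ) ^ (σ.card - ρ.card) • A ρ

variable {A : Finset I → H} {b : ℕ → ℝ}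

theorem inner_alternatingSum_left (hA : ∀ σ τ, inner ℝ (A σ) (A τ) = b (σ ∩ τ).card)
    (σ τ : Finset I) : inner ℝ (alternatingSum A σ) (A τ) =
      ∑ ρ ∈ σ.powerset, (-1 : ℝ) ^ (σ.card - ρ.card) * b (ρ ∩ τ).card := by
  simp only [alternatingSum, sum_inner, inner_smul_left, hA]
  simp

/-- For `i ∈ σ \ τ` the subsets `ρ` and `insert i ρ` meet `τ` in the same set and carry opposite
signs. -/
theorem inner_alternatingSum_eq_zero (hA : ∀ σ τ, inner ℝ (A σ) (A τ) = b (σ ∩ τ).card)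
    {σ τ : Finset I} (hστ : ¬σ ⊆ τ) : inner ℝ (alternatingSum A σ) (A τ) = 0 := by
  obtain ⟨i, hiσ, hiτ⟩ := Finset.not_subset.1 hστ
  rw [inner_alternatingSum_left hA]
  obtain ⟨σ', hi, rfl⟩ : ∃ σ', i ∉ σ' ∧ σ = insert i σ' :=
    ⟨σ.erase i, Finset.notMem_erase _ _, (Finset.insert_erase hiσ).symm⟩
  rw [Finset.sum_powerset_insert hi, ← Finset.sum_add_distrib]
  refine Finset.sum_eq_zero fun ρ hρ => ?_
  have hρ' := Finset.mem_powerset.1 hρ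
  have hc := Finset.card_le_card hρ'
  rw [Finset.insert_inter_of_notMem hiτ, Finset.card_insert_of_notMem hi,
    Finset.card_insert_of_notMem fun h => hi (hρ' h), Nat.succ_sub hc, Nat.add_sub_add_right,
    pow_succ]
  ring

theorem inner_alternatingSum_of_subset (hA : ∀ σ τ, inner ℝ (A σ) (A τ) = b (σ ∩ τ).card)
    {σ τ : Finset I} (hστ : σ ⊆ τ) : inner ℝ (alternatingSum A σ) (A τ) =
      ∑ k ∈ Finset.range (σ.card + 1), σ.card.choose k • ((-1 : ℝ) ^ (σ.card - k) * b k) := by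
  rw [inner_alternatingSum_left hA, ← Finset.sum_powerset_apply_card]
  refine Finset.sum_congr rfl fun ρ hρ => ?_
  rw [Finset.inter_eq_left.2 ((Finset.mem_powerset.1 hρ).trans hστ)]

/-- Expanding the second factor, a subset of `τ` can contain `σ`, of the same size, only if it is
`τ` itself and `σ = τ`. -/
theorem inner_alternatingSum_alternatingSum
    (hA : ∀ σ τ, inner ℝ (A σ) (A τ) = b (σ ∩ τ).card) {σ τ : Finset I}
    (hc : σ.card = τ.card) : inner ℝ (alternatingSum A σ) (alternatingSum A τ) =
      if σ = τ then inner ℝ (alternatingSum A σ) (A σ) else 0 := by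
  conv_lhs => rw [alternatingSum.eq_1 A τ]
  rw [inner_sum, Finset.sum_eq_single τ]
  · split_ifs with h
    · subst h; simp
    · rw [inner_smul_right, inner_alternatingSum_eq_zero hA fun hs =>
        h (Finset.eq_of_subset_of_card_le hs hc.ge), mul_zero]
  · intro ρ hρ hρτ
    rw [inner_smul_right, inner_alternatingSum_eq_zero hA, mul_zero]
    intro hs
    have hρ' := Finset.mem_powerset.1 hρ
    exact hρτ (Finset.eq_of_subset_of_card_le hρ' (hc ▸ Finset.card_le_card hs))
  · intro h
    exact absurd (Finset.mem_powerset_self τ) h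

/-- Bessel's inequality for the orthogonal (Hoeffding) decomposition. -/
theorem choose_mul_norm_alternatingSum_sq_le [Fintype I]
    (hA : ∀ σ τ, inner ℝ (A σ) (A τ) = b (σ ∩ τ).card) (σ₀ : Finset I) :
    ((Fintype.card I).choose σ₀.card : ℝ) * ‖alternatingSum A σ₀‖ ^ 2 ≤
      ‖A Finset.univ‖ ^ 2 := by
  set S := Finset.powersetCard σ₀.card (Finset.univ : Finset I) with hS
  -- The component of `A univ` of the given order: `⟪Ψ, A univ⟫ = ⟪Ψ, Ψ⟫`, and expanding `‖A univ -
  -- Ψ‖ ^ 2 ≥ 0` gives the bound.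
  set Ψ := ∑ σ ∈ S, alternatingSum A σ with hΨ
  have hcard : ∀ σ ∈ S, σ.card = σ₀.card := fun σ hσ => (Finset.mem_powersetCard.1 hσ).2
  have hnorm : ‖alternatingSum A σ₀‖ ^ 2 = inner ℝ (alternatingSum A σ₀) (A σ₀) := by
    rw [← real_inner_self_eq_norm_sq, inner_alternatingSum_alternatingSum hA rfl, if_pos rfl]
  have hsub : ∀ σ ∈ S, ∀ τ, σ ⊆ τ → inner ℝ (alternatingSum A σ) (A τ) =
      ‖alternatingSum A σ₀‖ ^ 2 := by
    intro σ hσ τ hτ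
    rw [hnorm, inner_alternatingSum_of_subset hA hτ,
      inner_alternatingSum_of_subset hA (Finset.Subset.refl σ₀), hcard σ hσ]
  have hΨA : inner ℝ Ψ (A Finset.univ) = S.card * ‖alternatingSum A σ₀‖ ^ 2 := by
    rw [hΨ, sum_inner, Finset.sum_congr rfl fun σ hσ => hsub σ hσ _ (Finset.subset_univ σ)]
    simp
  have hΨΨ : inner ℝ Ψ Ψ = S.card * ‖alternatingSum A σ₀‖ ^ 2 := by
    have : ∀ σ ∈ S, inner ℝ (alternatingSum A σ) Ψ = ‖alternatingSum A σ₀‖ ^ 2 := by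
      intro σ hσ
      rw [hΨ, inner_sum, Finset.sum_congr rfl fun τ hτ =>
        inner_alternatingSum_alternatingSum hA ((hcard σ hσ).trans (hcard τ hτ).symm)]
      rw [Finset.sum_ite_eq, if_pos hσ, hsub σ hσ _ (Finset.Subset.refl σ)]
    conv_lhs => rw [hΨ]
    rw [sum_inner, Finset.sum_congr rfl this]
    simp
  have h := norm_sub_sq_real (A Finset.univ) Ψ
  rw [real_inner_comm, hΨA, ← real_inner_self_eq_norm_sq Ψ, hΨΨ] at h
  have h2 := sq_nonneg ‖A Finset.univ - Ψ‖
  have h3 : S.card = (Fintype.card I).choose σ₀.card := by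
    rw [hS, Finset.card_powersetCard, Finset.card_univ]
  rw [h3] at h
  linarith

end Anova

/-! ### Product measures and coordinate projections -/

section Product

open scoped ENNReal

theorem lintegral_fin_prod_eq_prod {α : Type*} [MeasurableSpace α] {μ : Measure α}
    [SigmaFinite μ] : ∀ {n : ℕ} (f : Fin n → α → ℝ≥0∞), (∀ i, Measurable (f i)) →
    ∫⁻ z : Fin n → α, ∏ i, f i (z i) ∂(Measure.pi fun _ => μ) = ∏ i, ∫⁻ x, f i x ∂μ := by
  intro n
  induction n with
  | zero => intro f _; simp
  | succ n ih =>
    intro f hf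
    have hmp := (measurePreserving_piFinSuccAbove (fun _ : Fin (n + 1) => μ) 0).symm
    have hmeas : Measurable fun z : Fin (n + 1) → α => ∏ i, f i (z i) :=
      Finset.measurable_fun_prod _ fun i _ => (hf i).comp (measurable_pi_apply i)
    have hm2 : Measurable fun z : Fin n → α => ∏ i, f (Fin.succ i) (z i) :=
      Finset.measurable_fun_prod _ fun i _ => (hf _).comp (measurable_pi_apply i)
    rw [← hmp.lintegral_comp hmeas, Fin.prod_univ_succ, ← ih (fun i => f i.succ) fun i => hf _,
      ← lintegral_prod_mul (hf 0).aemeasurable hm2.aemeasurable]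
    refine lintegral_congr fun p => ?_
    rw [Fin.prod_univ_succ]
    rfl

theorem pi_withDensity_eq {α : Type*} [MeasurableSpace α] {μ : Measure α} [SigmaFinite μ]
    {f : α → ℝ≥0∞} (hf : Measurable f) [SigmaFinite (μ.withDensity f)] (n : ℕ) :
    (Measure.pi fun _ : Fin n => μ).withDensity (fun z => ∏ i, f (z i)) =
      Measure.pi fun _ : Fin n => μ.withDensity f := by
  refine (Measure.pi_eq fun s hs => ?_).symm
  rw [withDensity_apply _ (MeasurableSet.univ_pi hs), ← lintegral_indicator (MeasurableSet.univ_pi hs)]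
  have h : ∀ z : Fin n → α, (Set.univ.pi s).indicator (fun z => ∏ i, f (z i)) z =
      ∏ i, (s i).indicator f (z i) := by
    intro z
    by_cases hz : z ∈ Set.univ.pi s
    · rw [Set.indicator_of_mem hz]
      exact Finset.prod_congr rfl fun i _ =>
        (Set.indicator_of_mem (hz i (Set.mem_univ i)) f).symm
    · rw [Set.indicator_of_notMem hz]
      simp only [Set.mem_pi, Set.mem_univ, true_implies, not_forall] at hz
      obtain ⟨i, hi⟩ := hz
      exact (Finset.prod_eq_zero (Finset.mem_univ i) (Set.indicator_of_notMem hi f)).symm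
  simp_rw [h]
  rw [lintegral_fin_prod_eq_prod _ fun i => hf.indicator (hs i)]
  exact Finset.prod_congr rfl fun i _ => by
    rw [lintegral_indicator (hs i), withDensity_apply _ (hs i)]

/-- The preimage of a box is a box with full sides in the missing coordinates, and those sides have
mass one. -/
theorem measurePreserving_comp_injective {α ι κ : Type*} [MeasurableSpace α] {μ : Measure α}
    [IsProbabilityMeasure μ] [Fintype ι] [Fintype κ] {e : ι → κ} (he : Function.Injective e) :
    MeasurePreserving (fun (z : κ → α) (i : ι) => z (e i)) (Measure.pi fun _ => μ)
      (Measure.pi fun _ => μ) := by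
  have hm : Measurable fun (z : κ → α) (i : ι) => z (e i) :=
    measurable_pi_lambda _ fun i => measurable_pi_apply _
  refine ⟨hm, (Measure.pi_eq fun s hs => ?_).symm⟩
  rw [Measure.map_apply hm (MeasurableSet.univ_pi hs)]
  have : (fun (z : κ → α) (i : ι) => z (e i)) ⁻¹' Set.univ.pi s =
      Set.univ.pi (Function.extend e s fun _ => Set.univ) := by
    ext z
    simp only [Set.mem_preimage, Set.mem_pi, Set.mem_univ, true_implies]
    constructor
    · intro h k
      by_cases hk : ∃ i, e i = k
      · obtain ⟨i, rfl⟩ := hk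
        rw [he.extend_apply]; exact h i
      · rw [Function.extend_apply' _ _ _ hk]; trivial
    · intro h i
      have := h (e i)
      rwa [he.extend_apply] at this
  rw [this, Measure.pi_pi]
  refine (Fintype.prod_of_injective e he _ _ (fun k hk => ?_) fun i => ?_).symm
  · rw [Function.extend_apply' _ _ _ hk, measure_univ]
  · rw [he.extend_apply]

end Product

/-! ### The Maxwellian as a product probability measure -/

section Maxwellian

open scoped ENNReal

variable {d : ℕ} {β : ℝ}

/-- The measure `M_β(v) dx dv` on the one-particle phase space. -/
noncomputable def maxwellPhase (d : ℕ) (β : ℝ) : Measure (Phase d) :=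
  volume.withDensity fun z => ENNReal.ofReal (maxwellian β z.2)

theorem maxwellian_pos (hβ : 0 < β) (v : Vel d) : 0 < maxwellian β v := by
  unfold maxwellian; positivity

theorem measurable_maxwellian : Measurable (maxwellian β : Vel d → ℝ) := by
  unfold maxwellian; fun_prop

theorem maxwellianProd_pos {k : ℕ} (hβ : 0 < β) (z : Fin k → Phase d) :
    0 < maxwellianProd β z :=
  Finset.prod_pos fun _ _ => maxwellian_pos hβ _

theorem measurable_maxwellianProd {k : ℕ} :
    Measurable (maxwellianProd β : (Fin k → Phase d) → ℝ) :=
  Finset.measurable_fun_prod _ fun j _ =>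
    measurable_maxwellian.comp (measurable_snd.comp (measurable_pi_apply j))

theorem integral_maxwellian (hβ : 0 < β) : ∫ v : Vel d, maxwellian β v = 1 := by
  have h := GaussianFourier.integral_rexp_neg_mul_sq_norm (V := Vel d) (b := β / 2) (by positivity)
  simp only [maxwellian]
  rw [integral_const_mul, h, finrank_euclideanSpace_fin,
    ← Real.mul_rpow (by positivity) (by positivity)]
  have : β / (2 * Real.pi) * (Real.pi / (β / 2)) = 1 := by
    field_simp
  rw [this, Real.one_rpow]

theorem integrable_maxwellian (hβ : 0 < β) : Integrable (maxwellian β : Vel d → ℝ) := by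
  by_contra h
  have := integral_maxwellian (d := d) hβ
  rw [integral_undef h] at this
  exact zero_ne_one this

theorem isProbabilityMeasure_maxwellPhase (hβ : 0 < β) :
    IsProbabilityMeasure (maxwellPhase d β) := by
  constructor
  have hm : Measurable fun v : Vel d => ENNReal.ofReal (maxwellian β v) :=
    measurable_maxwellian.ennreal_ofReal
  have h1 : ∫⁻ v : Vel d, ENNReal.ofReal (maxwellian β v) = 1 := by
    rw [← ofReal_integral_eq_lintegral_ofReal (integrable_maxwellian hβ)
      (ae_of_all _ fun v => (maxwellian_pos hβ v).le), integral_maxwellian hβ, ENNReal.ofReal_one]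
  rw [maxwellPhase, withDensity_apply _ MeasurableSet.univ, Measure.restrict_univ,
    Measure.volume_eq_prod,
    lintegral_prod (fun z : Phase d => ENNReal.ofReal (maxwellian β z.2))
      (hm.comp measurable_snd).aemeasurable]
  simp [h1]

/-- The product structure is what turns integrating out particles into conditional expectation. -/
theorem maxwellMeasure_eq_pi (hβ : 0 < β) (k : ℕ) :
    maxwellMeasure d k β = Measure.pi fun _ => maxwellPhase d β := by
  have := isProbabilityMeasure_maxwellPhase (d := d) hβ
  have hm : Measurable fun z : Phase d => ENNReal.ofReal (maxwellian β z.2) :=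
    (measurable_maxwellian.comp measurable_snd).ennreal_ofReal
  have : SigmaFinite ((volume : Measure (Phase d)).withDensity
      fun z => ENNReal.ofReal (maxwellian β z.2)) :=
    inferInstanceAs (SigmaFinite (maxwellPhase d β))
  unfold maxwellPhase
  rw [← pi_withDensity_eq hm]
  unfold maxwellMeasure maxwellianProd
  congr 1
  ext z
  exact ENNReal.ofReal_prod_of_nonneg fun j _ => (maxwellian_pos hβ _).le

theorem isProbabilityMeasure_maxwellMeasure (hβ : 0 < β) (k : ℕ) :
    IsProbabilityMeasure (maxwellMeasure d k β) := by
  have := isProbabilityMeasure_maxwellPhase (d := d) hβ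
  rw [maxwellMeasure_eq_pi hβ]; infer_instance

theorem measurePreserving_maxwellMeasure (hβ : 0 < β) {k n : ℕ} {e : Fin k → Fin n}
    (he : Function.Injective e) :
    MeasurePreserving (fun (z : Fin n → Phase d) i => z (e i)) (maxwellMeasure d n β)
      (maxwellMeasure d k β) := by
  have := isProbabilityMeasure_maxwellPhase (d := d) hβ
  rw [maxwellMeasure_eq_pi hβ, maxwellMeasure_eq_pi hβ]
  exact measurePreserving_comp_injective he

theorem lintegral_maxwellMeasure {k : ℕ} {G : (Fin k → Phase d) → ℝ≥0∞} (hG : Measurable G) :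
    ∫⁻ z, G z ∂maxwellMeasure d k β = ∫⁻ z, ENNReal.ofReal (maxwellianProd β z) * G z := by
  rw [maxwellMeasure, lintegral_withDensity_eq_lintegral_mul _
    measurable_maxwellianProd.ennreal_ofReal hG]
  rfl

theorem maxwellianProd_eq {k : ℕ} (z : Fin k → Phase d) :
    maxwellianProd β z = ((β / (2 * Real.pi)) ^ ((d : ℝ) / 2)) ^ k * Real.exp (-β * kinetic z) := by
  simp only [maxwellianProd, maxwellian, Finset.prod_mul_distrib, Finset.prod_const,
    Finset.card_univ, Fintype.card_fin, ← Real.exp_sum, kinetic, ← Finset.mul_sum]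
  congr 2
  ring

end Maxwellian

/-! ### Bounds on the Gibbs density, uniform in the number of particles -/

section Gibbs

open scoped ENNReal

variable {d N : ℕ} {β : ℝ}

/-- The bound holds on a closed set of full measure, which is dense and hence everything. -/
theorem abs_le_eLpNorm_top {V : Torus d → ℝ} (hV : Continuous V) (x : Torus d) :
    |V x| ≤ (eLpNorm V ⊤ volume).toReal := by
  have hfin : eLpNorm V ⊤ volume ≠ ∞ := by
    obtain ⟨A, hA⟩ := isCompact_univ.exists_bound_of_continuousOn hV.continuousOn
    exact (memLp_top_of_bound hV.aestronglyMeasurable A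
      (ae_of_all _ fun y => hA y (Set.mem_univ y))).eLpNorm_ne_top
  have hae : ∀ᵐ y : Torus d, |V y| ≤ (eLpNorm V ⊤ volume).toReal := by
    filter_upwards [ae_le_eLpNormEssSup (f := V) (μ := volume)] with y hy
    rw [← eLpNorm_exponent_top] at hy
    have := ENNReal.toReal_mono hfin hy
    simpa using this
  have hclosed : IsClosed {y | |V y| ≤ (eLpNorm V ⊤ volume).toReal} :=
    isClosed_le hV.abs continuous_const
  have := (Measure.dense_of_ae hae).closure_eq
  rw [hclosed.closure_eq] at this
  have hx : x ∈ {y | |V y| ≤ (eLpNorm V ⊤ volume).toReal} := this ▸ Set.mem_univ x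
  exact hx

/-- The potential with its mean subtracted. -/
noncomputable def centered (V : Torus d → ℝ) (x : Torus d) : ℝ := V x - ∫ y, V y

theorem abs_centered_le {V : Torus d → ℝ} {A : ℝ} (hA : ∀ x, |V x| ≤ A) (x : Torus d) :
    |centered V x| ≤ 2 * A := by
  have h : |∫ y, V y| ≤ A := by
    have h := norm_integral_le_of_norm_le_const (f := V) (C := A) (ae_of_all volume hA)
    simpa using h
  unfold centered
  linarith [abs_sub (V x) (∫ y, V y), hA x]

theorem IsPotential.continuous_centered {V : Torus d → ℝ} (hV : IsPotential V) :
    Continuous (centered V) :=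
  hV.continuous.sub continuous_const

theorem IsPotential.integrable {V : Torus d → ℝ} (hV : IsPotential V) : Integrable V := by
  obtain ⟨A, hA⟩ := isCompact_univ.exists_bound_of_continuousOn hV.continuous.continuousOn
  exact (integrable_const A).mono' hV.continuous.aestronglyMeasurable
    (ae_of_all _ fun y => hA y (Set.mem_univ y))

theorem IsPotential.integral_centered {V : Torus d → ℝ} (hV : IsPotential V) :
    ∫ x, centered V x = 0 := by
  unfold centered
  rw [integral_sub hV.integrable (integrable_const _)]
  simp

theorem measurable_interaction {ι : Type*} [Fintype ι] [DecidableEq ι] {V : Torus d → ℝ}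
    (hV : Measurable V) : Measurable (interaction N V : (ι → Phase d) → ℝ) := by
  unfold interaction
  refine Measurable.const_mul (Finset.measurable_fun_sum _ fun j _ =>
    Finset.measurable_fun_sum _ fun l _ => hV.comp ?_) _
  fun_prop

theorem measurable_kinetic {ι : Type*} [Fintype ι] :
    Measurable (kinetic : (ι → Phase d) → ℝ) := by
  unfold kinetic
  fun_prop

/-- With the diagonal included, the centered double sum is nonnegative by positive definiteness.
Removing the diagonal costs `card ι * centered V 0 ≤ 2 * N * (2 * A)`, of the order of the
normalization `2 * N`. The bound on `card ι` covers `N` and, for `N ≥ 1`, `N + 1` particles. -/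
theorem interaction_centered_ge {ι : Type*} [Fintype ι] [DecidableEq ι] {V : Torus d → ℝ}
    (hV : IsPotential V) {A : ℝ} (hA : ∀ x, |V x| ≤ A) (hι : Fintype.card ι ≤ 2 * N)
    (z : ι → Phase d) : -(2 * A) ≤ interaction N (centered V) z := by
  have hA0 : 0 ≤ A := (abs_nonneg _).trans (hA 0)
  rcases Nat.eq_zero_or_pos N with hN | hN
  · simp [interaction, hN, hA0]
  have hN' : (0 : ℝ) < N := by exact_mod_cast hN
  have h1 := sum_sum_ge_of_mFourierCoeff_nonneg hV.continuous hV.fourier_re hV.fourier_im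
    fun j => (z j).1
  have h2 : ∀ j, ∑ l ∈ Finset.univ.erase j, centered V ((z j).1 - (z l).1) =
      ∑ l, V ((z j).1 - (z l).1) - Fintype.card ι * (∫ y, V y) - centered V 0 := by
    intro j
    rw [Finset.sum_erase_eq_sub (Finset.mem_univ j)]
    simp [centered, Finset.sum_sub_distrib]
  unfold interaction
  simp_rw [h2, Finset.sum_sub_distrib]
  simp only [Finset.sum_const, Finset.card_univ, nsmul_eq_mul]
  have h3 := (abs_le.1 (abs_centered_le hA 0)).2
  have h4 : (Fintype.card ι : ℝ) ≤ 2 * N := by exact_mod_cast hι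
  have h5 : (Fintype.card ι : ℝ) * centered V 0 ≤ 2 * N * (2 * A) :=
    (mul_le_mul_of_nonneg_left h3 (by positivity)).trans
      (mul_le_mul_of_nonneg_right h4 (by positivity))
  rw [one_div, ← div_eq_inv_mul, le_div_iff₀ (by positivity)]
  nlinarith

/-- Particle `0` adds `2 * N` ordered pairs, each weighted by `1 / (2 * N)`. -/
theorem interaction_succ_le {W : Torus d → ℝ} {B : ℝ} (hB : ∀ x, |W x| ≤ B)
    (z : Fin (N + 1) → Phase d) :
    interaction N W z ≤ interaction N W (fun j : Fin N => z j.succ) + B := by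
  have hB0 : 0 ≤ B := (abs_nonneg _).trans (hB 0)
  rcases Nat.eq_zero_or_pos N with hN | hN
  · simp [interaction, hN, hB0]
  have hN' : (0 : ℝ) < N := by exact_mod_cast hN
  have key : ∑ j, ∑ l ∈ Finset.univ.erase j, W ((z j).1 - (z l).1) =
      ∑ j : Fin N, ∑ l ∈ Finset.univ.erase j, W ((z j.succ).1 - (z l.succ).1) +
      ∑ j : Fin N, (W ((z 0).1 - (z j.succ).1) + W ((z j.succ).1 - (z 0).1)) := by
    simp_rw [Finset.sum_erase_eq_sub (Finset.mem_univ _), Finset.sum_sub_distrib,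
      Fin.sum_univ_succ, Finset.sum_add_distrib]
    ring
  have hsum : ∑ j : Fin N, (W ((z 0).1 - (z j.succ).1) + W ((z j.succ).1 - (z 0).1)) ≤
      N * (2 * B) := by
    refine (Finset.sum_le_sum (g := fun _ => 2 * B) fun j _ => ?_).trans (by simp)
    linarith [(abs_le.1 (hB ((z 0).1 - (z j.succ).1))).2,
      (abs_le.1 (hB ((z j.succ).1 - (z 0).1))).2]
  unfold interaction
  rw [key, mul_add]
  have : 1 / (2 * (N : ℝ)) * (N * (2 * B)) = B := by field_simp
  have := mul_le_mul_of_nonneg_left hsum (show 0 ≤ 1 / (2 * (N : ℝ)) by positivity)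
  linarith

theorem exists_interaction_eq_centered_add (V : Torus d → ℝ) (N : ℕ) (ι : Type*) [Fintype ι]
    [DecidableEq ι] :
    ∃ s, ∀ z : ι → Phase d, interaction N V z = interaction N (centered V) z + s := by
  refine ⟨1 / (2 * (N : ℝ)) * ∑ j : ι, ∑ _l ∈ Finset.univ.erase j, ∫ y, V y, fun z => ?_⟩
  unfold interaction centered
  rw [← mul_add, ← Finset.sum_add_distrib]
  simp_rw [← Finset.sum_add_distrib, sub_add_cancel]

theorem gibbsWeight_eq (V : Torus d → ℝ) (z : Fin N → Phase d) :
    gibbsWeight β V z = Real.exp (-β * kinetic z) * Real.exp (-β * interaction N V z) := by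
  rw [gibbsWeight, ← Real.exp_add, kinetic, interaction]
  congr 1
  ring

/-- Centering shifts the energy by a constant, which the normalization removes. -/
theorem gibbs_centered (V : Torus d → ℝ) (z : Fin N → Phase d) :
    gibbs β V z = gibbs β (centered V) z := by
  obtain ⟨s, hs⟩ := exists_interaction_eq_centered_add V N (Fin N)
  have h : ∀ w : Fin N → Phase d,
      gibbsWeight β V w = Real.exp (-β * s) * gibbsWeight β (centered V) w := by
    intro w
    rw [gibbsWeight_eq, gibbsWeight_eq, hs, mul_add, Real.exp_add]
    ring
  unfold gibbs
  simp_rw [h]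
  rw [integral_const_mul, mul_inv]
  have := (Real.exp_pos (-β * s)).ne'
  field_simp

/-- Translating the position of particle `j` alone preserves the measure; averaging over all
translations produces the mean of `centered V`. -/
theorem integral_centered_sub_eq_zero {V : Torus d → ℝ} (hV : IsPotential V) (hβ : 0 < β)
    {n : ℕ} {j l : Fin n} (hjl : j ≠ l) :
    ∫ z, centered V ((z j).1 - (z l).1) ∂maxwellMeasure d n β = 0 := by
  have := isProbabilityMeasure_maxwellPhase (d := d) hβ
  have := isProbabilityMeasure_maxwellMeasure (d := d) hβ n
  obtain ⟨A, hA⟩ := isCompact_univ.exists_bound_of_continuousOn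
    hV.continuous_centered.continuousOn
  have hm : Measurable (centered V) := hV.continuous_centered.measurable
  set T : Torus d → (Fin n → Phase d) → Fin n → Phase d := fun a z i =>
    (if i = j then (z i).1 + a else (z i).1, (z i).2) with hT
  have hTmp : ∀ a, MeasurePreserving (T a) (maxwellMeasure d n β) (maxwellMeasure d n β) := by
    intro a
    rw [maxwellMeasure_eq_pi hβ]
    refine measurePreserving_pi (f := fun i (p : Phase d) =>
      (if i = j then p.1 + a else p.1, p.2)) _ _ fun i => ?_
    by_cases hi : i = j
    · simp only [hi, if_true]
      have h0 : MeasurePreserving (fun p : Phase d => (p.1 + a, p.2)) volume volume :=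
        (measurePreserving_add_right volume a).prod (MeasurePreserving.id _)
      refine ⟨h0.measurable, ?_⟩
      have hdm : Measurable fun p : Phase d => ENNReal.ofReal (maxwellian β p.2) :=
        (measurable_maxwellian.comp measurable_snd).ennreal_ofReal
      ext s hs
      rw [Measure.map_apply h0.measurable hs, maxwellPhase,
        withDensity_apply _ (h0.measurable hs), withDensity_apply _ hs]
      exact h0.setLIntegral_comp_preimage hs hdm
    · simp only [hi, if_false]
      exact MeasurePreserving.id _
  have hmeas : Measurable fun z : Fin n → Phase d => centered V ((z j).1 - (z l).1) :=
    hm.comp (by fun_prop)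
  have h1 : ∀ a, ∫ z, centered V ((z j).1 - (z l).1) ∂maxwellMeasure d n β =
      ∫ z, centered V ((z j).1 + a - (z l).1) ∂maxwellMeasure d n β := by
    intro a
    conv_lhs => rw [← (hTmp a).map_eq]
    rw [integral_map (hTmp a).measurable.aemeasurable hmeas.aestronglyMeasurable]
    simp only [hT, if_true, if_neg hjl.symm]
  have hint : Integrable (Function.uncurry fun (a : Torus d) (z : Fin n → Phase d) =>
      centered V ((z j).1 + a - (z l).1)) (volume.prod (maxwellMeasure d n β)) :=
    (integrable_const A).mono' (hm.comp (by fun_prop)).aestronglyMeasurable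
      (ae_of_all _ fun p => hA _ (Set.mem_univ _))
  have h2 : ∫ z, centered V ((z j).1 - (z l).1) ∂maxwellMeasure d n β =
      ∫ a : Torus d, ∫ z, centered V ((z j).1 + a - (z l).1) ∂maxwellMeasure d n β := by
    rw [← integral_congr_ae (ae_of_all _ h1)]
    simp
  rw [h2, integral_integral_swap hint]
  have h3 : ∀ z : Fin n → Phase d, ∫ a, centered V ((z j).1 + a - (z l).1) = 0 := by
    intro z
    have : ∀ a, (z j).1 + a - (z l).1 = a + ((z j).1 - (z l).1) := fun a => by abel
    simp_rw [this]
    rw [integral_add_right_eq_self (centered V), hV.integral_centered]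
  simp [h3]

/-- The partition function of the centered potential is at least that of free particles. -/
theorem one_le_integral_exp_interaction {V : Torus d → ℝ} (hV : IsPotential V) (hβ : 0 < β) :
    1 ≤ ∫ z, Real.exp (-β * interaction N (centered V) z) ∂maxwellMeasure d N β := by
  have := isProbabilityMeasure_maxwellMeasure (d := d) hβ N
  have hA := abs_le_eLpNorm_top hV.continuous
  set A := (eLpNorm V ⊤ volume).toReal
  have hm := measurable_interaction (N := N) (ι := Fin N) hV.continuous_centered.measurable
  have hWi : ∀ j l : Fin N, Integrable (fun z : Fin N → Phase d =>
      centered V ((z j).1 - (z l).1)) (maxwellMeasure d N β) := fun j l =>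
    (integrable_const (2 * A)).mono'
      (hV.continuous_centered.measurable.comp (by fun_prop)).aestronglyMeasurable
      (ae_of_all _ fun z => abs_centered_le hA _)
  have hUi : Integrable (interaction N (centered V)) (maxwellMeasure d N β) :=
    (integrable_finsetSum _ fun j _ => integrable_finsetSum _ fun l _ => hWi j l).const_mul _
  have hU0 : ∫ z, interaction N (centered V) z ∂maxwellMeasure d N β = 0 := by
    unfold interaction
    rw [integral_const_mul, integral_finsetSum _ fun j _ =>
      integrable_finsetSum _ fun l _ => hWi j l]
    rw [Finset.sum_eq_zero, mul_zero]
    intro j _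
    rw [integral_finsetSum _ fun l _ => hWi j l]
    exact Finset.sum_eq_zero fun l hl =>
      integral_centered_sub_eq_zero hV hβ (Finset.ne_of_mem_erase hl).symm
  have hei : Integrable (fun z => Real.exp (-β * interaction N (centered V) z))
      (maxwellMeasure d N β) := by
    refine (integrable_const (Real.exp (β * (2 * A)))).mono'
      (hm.const_mul _).exp.aestronglyMeasurable (ae_of_all _ fun z => ?_)
    rw [Real.norm_of_nonneg (Real.exp_pos _).le]
    refine Real.exp_le_exp.2 ?_
    have := interaction_centered_ge (N := N) hV hA (by simp; omega) z
    nlinarith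
  -- Jensen's inequality in the form `x + 1 ≤ exp x`, the exponent having mean zero.
  calc (1 : ℝ) = ∫ z, (-β * interaction N (centered V) z + 1) ∂maxwellMeasure d N β := by
        rw [integral_add (hUi.const_mul _) (integrable_const _), integral_const_mul, hU0]
        simp
    _ ≤ _ := integral_mono ((hUi.const_mul _).add (integrable_const _)) hei
        fun z => Real.add_one_le_exp _

theorem gibbs_nonneg (V : Torus d → ℝ) (z : Fin N → Phase d) : 0 ≤ gibbs β V z :=
  mul_nonneg (inv_nonneg.2 (integral_nonneg fun _ => (Real.exp_pos _).le)) (Real.exp_pos _).le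

theorem gibbs_le {V : Torus d → ℝ} (hV : IsPotential V) (hβ : 0 < β) (z : Fin N → Phase d) :
    gibbs β V z ≤ maxwellianProd β z * Real.exp (-β * interaction N (centered V) z) := by
  have hκ : 0 < ((β / (2 * Real.pi)) ^ ((d : ℝ) / 2)) ^ N := by positivity
  set κ := ((β / (2 * Real.pi)) ^ ((d : ℝ) / 2)) ^ N with hκd
  have hw : ∀ w : Fin N → Phase d, gibbsWeight β (centered V) w =
      κ⁻¹ * (maxwellianProd β w * Real.exp (-β * interaction N (centered V) w)) := by
    intro w
    rw [gibbsWeight_eq, maxwellianProd_eq, ← hκd]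
    field_simp
  have hZ : ∫ w : Fin N → Phase d, gibbsWeight β (centered V) w =
      κ⁻¹ * ∫ z, Real.exp (-β * interaction N (centered V) z) ∂maxwellMeasure d N β := by
    simp_rw [hw]
    rw [integral_const_mul, maxwellMeasure, integral_withDensity_eq_integral_toReal_smul
      measurable_maxwellianProd.ennreal_ofReal (ae_of_all _ fun _ => ENNReal.ofReal_lt_top)]
    congr 1
    refine integral_congr_ae (ae_of_all _ fun z => ?_)
    simp only [smul_eq_mul]
    rw [ENNReal.toReal_ofReal (maxwellianProd_pos hβ z).le]
  rw [gibbs_centered, gibbs, hZ, hw, mul_inv, inv_inv]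
  have h1 := one_le_integral_exp_interaction (N := N) hV hβ
  set E := ∫ z, Real.exp (-β * interaction N (centered V) z) ∂maxwellMeasure d N β
  have h2 : E⁻¹ ≤ 1 := inv_le_one_of_one_le₀ h1
  have h3 : 0 ≤ maxwellianProd β z * Real.exp (-β * interaction N (centered V) z) :=
    mul_nonneg (maxwellianProd_pos hβ z).le (Real.exp_pos _).le
  calc κ * E⁻¹ * (κ⁻¹ * (maxwellianProd β z * Real.exp (-β * interaction N (centered V) z)))
      = E⁻¹ * (maxwellianProd β z * Real.exp (-β * interaction N (centered V) z)) := by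
        field_simp
    _ ≤ _ := mul_le_of_le_one_left h3 h2

end Gibbs

/-! ### The uniform `L²` bound and the symmetry of the law -/

section Law

open scoped ENNReal

variable {d N : ℕ} {β : ℝ} {V : Torus d → ℝ} {f : Vel d → ℝ} {t : ℝ}

theorem measurable_gibbs (hV : IsPotential V) :
    Measurable (gibbs β V : (Fin N → Phase d) → ℝ) := by
  have h : (gibbs β V : (Fin N → Phase d) → ℝ) = fun z =>
      (∫ w : Fin N → Phase d, gibbsWeight β V w)⁻¹ *
        (Real.exp (-β * kinetic z) * Real.exp (-β * interaction N V z)) := by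
    ext z; rw [gibbs, gibbsWeight_eq]
  rw [h]
  exact ((measurable_kinetic.const_mul _).exp.mul
    ((measurable_interaction hV.continuous.measurable).const_mul _).exp).const_mul _

theorem measurable_initialDensity (hV : IsPotential V) (hf : Measurable f) :
    Measurable (initialDensity (N := N) β V f) :=
  (hf.comp (by fun_prop)).mul ((measurable_gibbs hV).comp (by fun_prop))

theorem law_absolutelyContinuous (hV : IsPotential V) (ht : 0 ≤ t) :
    law N β V f t ≪ volume := by
  refine ((withDensity_absolutelyContinuous _ _).map (measurable_newtonFlow hV ht)).trans ?_
  exact Measure.absolutelyContinuous_of_le (map_newtonFlow_le hV ht)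

theorem initialDensity_le (hV : IsPotential V) (hβ : 0 < β) (hf0 : ∀ v, 0 ≤ f v)
    (z : Fin (N + 1) → Phase d) :
    initialDensity β V f z ≤ f (z 0).2 / maxwellian β (z 0).2 * (maxwellianProd β z *
      Real.exp (-β * interaction N (centered V) (fun j : Fin N => z j.succ))) := by
  have h1 : maxwellianProd β z = maxwellian β (z 0).2 *
      maxwellianProd β (fun j : Fin N => z j.succ) := by
    simp only [maxwellianProd, Fin.prod_univ_succ]
  have h2 := (maxwellian_pos hβ (z 0).2).ne'
  rw [h1, initialDensity]
  refine (mul_le_mul_of_nonneg_left (gibbs_le hV hβ _) (hf0 _)).trans (le_of_eq ?_)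
  field_simp

/-- The a priori estimate: the density at time `t`, divided by the Maxwellian, is bounded in
`L²_β`, uniformly in the number of particles and in time. -/
theorem lintegral_rnDeriv_law_sq_le (hV : IsPotential V) (hβ : 0 < β)
    (hVβ : β * (eLpNorm V ⊤ volume).toReal ≤ 2) (hN : 1 ≤ N) (hf : Measurable f)
    (hf0 : ∀ v, 0 ≤ f v) (ht : 0 ≤ t) :
    ∫⁻ z, (law N β V f t).rnDeriv volume z ^ 2 * (ENNReal.ofReal (maxwellianProd β z))⁻¹ ≤
      ENNReal.ofReal (Real.exp 12) * ∫⁻ z : Fin 1 → Phase d,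
        ENNReal.ofReal (f (z 0).2 / maxwellian β (z 0).2) ^ 2 ∂maxwellMeasure d 1 β := by
  have hA := abs_le_eLpNorm_top hV.continuous
  set A := (eLpNorm V ⊤ volume).toReal
  have hW : Measurable (centered V) := hV.continuous_centered.measurable
  have hU := interaction_centered_ge (N := N) (ι := Fin (N + 1)) hV hA (by simp; omega)
  have hU' := interaction_centered_ge (N := N) (ι := Fin N) hV hA (by simp; omega)
  have hUU := interaction_succ_le (N := N) (abs_centered_le hA)
  set U : (Fin (N + 1) → Phase d) → ℝ := interaction N (centered V) with hUdef
  have hUm : Measurable U := measurable_interaction hW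
  have hκ : 0 < ((β / (2 * Real.pi)) ^ ((d : ℝ) / 2)) ^ (N + 1) := by positivity
  have hM := fun z : Fin (N + 1) → Phase d => maxwellianProd_eq (β := β) z
  set κ := ((β / (2 * Real.pi)) ^ ((d : ℝ) / 2)) ^ (N + 1) with hκd
  -- The invariant weight uses the centered interaction: it still differs from the conserved energy
  -- by a constant, but is now bounded below independently of `N`.
  set w : (Fin (N + 1) → Phase d) → ℝ≥0∞ := fun z =>
    ENNReal.ofReal (Real.exp (β * (kinetic z + U z))) with hw
  have hwm : Measurable w := ((measurable_kinetic.add hUm).const_mul _).exp.ennreal_ofReal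
  have hw0 : ∀ z, w z ≠ 0 := fun z => (ENNReal.ofReal_pos.2 (Real.exp_pos _)).ne'
  have hwt : ∀ z, w z ≠ ∞ := fun z => ENNReal.ofReal_ne_top
  have hinv : ∀ z, w (newtonFlow V t z) = w z := by
    intro z
    obtain ⟨s, hs⟩ := exists_interaction_eq_centered_add V N (Fin (N + 1))
    have h := energy_newtonFlow hV z t
    rw [hs, hs] at h
    simp only [hw]
    congr 3
    linarith
  have hFm : Measurable fun z => ENNReal.ofReal (initialDensity (N := N) β V f z) :=
    (measurable_initialDensity hV hf).ennreal_ofReal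
  have hMm : Measurable fun z : Fin (N + 1) → Phase d => ENNReal.ofReal (maxwellianProd β z) :=
    measurable_maxwellianProd.ennreal_ofReal
  have hwinv : ∀ z, (w z)⁻¹ ≤ ENNReal.ofReal (κ⁻¹ * Real.exp 4) *
      ENNReal.ofReal (maxwellianProd β z) := by
    intro z
    rw [← ENNReal.ofReal_inv_of_pos (Real.exp_pos _), ← ENNReal.ofReal_mul (by positivity)]
    refine ENNReal.ofReal_le_ofReal ?_
    rw [hM, ← Real.exp_neg]
    have : κ⁻¹ * Real.exp 4 * (κ * Real.exp (-β * kinetic z)) =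
        Real.exp (4 + -β * kinetic z) := by
      rw [Real.exp_add]; field_simp
    rw [this]
    refine Real.exp_le_exp.2 ?_
    nlinarith [hU z]
  have hfin : ∫⁻ z, (w z)⁻¹ ≠ ∞ := by
    refine ne_top_of_le_ne_top ?_ (lintegral_mono hwinv)
    rw [lintegral_const_mul _ hMm]
    have h1 : ∫⁻ z : Fin (N + 1) → Phase d, ENNReal.ofReal (maxwellianProd β z) = 1 := by
      have := isProbabilityMeasure_maxwellMeasure (d := d) hβ (N + 1)
      have h := measure_univ (μ := maxwellMeasure d (N + 1) β)
      rwa [maxwellMeasure, withDensity_apply _ MeasurableSet.univ, Measure.restrict_univ] at h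
    rw [h1]
    finiteness
  -- Here `U ≥ -2 * A` and `β * A ≤ 2`, whence `exp 4`.
  have hMinv : ∀ z : Fin (N + 1) → Phase d, (ENNReal.ofReal (maxwellianProd β z))⁻¹ ≤
      ENNReal.ofReal (κ⁻¹ * Real.exp 4) * w z := by
    intro z
    rw [← ENNReal.ofReal_inv_of_pos (maxwellianProd_pos hβ z),
      ← ENNReal.ofReal_mul (by positivity)]
    refine ENNReal.ofReal_le_ofReal ?_
    rw [hM, mul_inv, ← Real.exp_neg, mul_assoc, ← Real.exp_add]
    refine mul_le_mul_of_nonneg_left (Real.exp_le_exp.2 ?_) (by positivity)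
    nlinarith [hU z]
  have hF : ∀ z, ENNReal.ofReal (initialDensity (N := N) β V f z) ^ 2 * w z ≤
      ENNReal.ofReal (κ * Real.exp 8) * (ENNReal.ofReal (maxwellianProd β z) *
        ENNReal.ofReal (f (z 0).2 / maxwellian β (z 0).2) ^ 2) := by
    intro z
    have hr : 0 ≤ f (z 0).2 / maxwellian β (z 0).2 :=
      div_nonneg (hf0 _) (maxwellian_pos hβ _).le
    have hFn : 0 ≤ initialDensity (N := N) β V f z := mul_nonneg (hf0 _) (gibbs_nonneg _ _)
    rw [← ENNReal.ofReal_pow hFn, ← ENNReal.ofReal_pow hr,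
      ← ENNReal.ofReal_mul (by positivity), ← ENNReal.ofReal_mul (maxwellianProd_pos hβ z).le,
      ← ENNReal.ofReal_mul (by positivity)]
    refine ENNReal.ofReal_le_ofReal ?_
    have h1 := pow_le_pow_left₀ hFn (initialDensity_le hV hβ hf0 z) 2
    refine (mul_le_mul_of_nonneg_right h1 (Real.exp_pos _).le).trans ?_
    set r := f (z 0).2 / maxwellian β (z 0).2
    set U' := interaction N (centered V) (fun j : Fin N => z j.succ)
    have h2 : (r * (maxwellianProd β z * Real.exp (-β * U'))) ^ 2 *
        Real.exp (β * (kinetic z + U z)) =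
        κ * Real.exp (-β * U' + -β * U' + β * U z) * (maxwellianProd β z * r ^ 2) := by
      rw [mul_add, Real.exp_add, Real.exp_add, Real.exp_add]
      have h3 : maxwellianProd β z * Real.exp (β * kinetic z) = κ := by
        rw [hM, mul_assoc, ← Real.exp_add]; simp
      rw [← h3]; ring
    rw [h2]
    -- The squared Gibbs factor supplies `-2 * U'` and the weight `+U`. One `U'` absorbs `U ≤ U' + 2
    -- * A`, the other is handled by `U' ≥ -2 * A`, so only lower bounds on `U'` are used. With the
    -- `exp 4` of `hMinv` this gives `exp 12`.
    have h4 : -β * U' + -β * U' + β * U z ≤ 8 := by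
      have h5 : -U' - U' + U z ≤ 4 * A := by linarith [hU' fun j : Fin N => z j.succ, hUU z]
      have h6 := mul_le_mul_of_nonneg_left h5 hβ.le
      linarith
    have := maxwellianProd_pos hβ z
    gcongr
  have hg := Measure.measurable_rnDeriv (law N β V f t) volume
  have hcontr := lintegral_sq_mul_le_of_map_le (measurable_newtonFlow hV ht)
    (map_newtonFlow_le hV ht) hwm hw0 hwt hinv hfin hFm hg
    (Measure.withDensity_rnDeriv_le (law N β V f t) volume)
  set g := (law N β V f t).rnDeriv volume
  have hrm : Measurable fun z : Fin 1 → Phase d =>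
      ENNReal.ofReal (f (z 0).2 / maxwellian β (z 0).2) ^ 2 :=
    (((hf.comp (by fun_prop)).div
      (measurable_maxwellian.comp (by fun_prop))).ennreal_ofReal).pow_const 2
  have hrm' : Measurable fun z : Fin (N + 1) → Phase d =>
      ENNReal.ofReal (f (z 0).2 / maxwellian β (z 0).2) ^ 2 :=
    (((hf.comp (by fun_prop)).div
      (measurable_maxwellian.comp (by fun_prop))).ennreal_ofReal).pow_const 2
  calc ∫⁻ z, g z ^ 2 * (ENNReal.ofReal (maxwellianProd β z))⁻¹
      ≤ ∫⁻ z, ENNReal.ofReal (κ⁻¹ * Real.exp 4) * (g z ^ 2 * w z) :=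
        lintegral_mono fun z => by
          rw [mul_left_comm]
          gcongr
          exact hMinv z
    _ = ENNReal.ofReal (κ⁻¹ * Real.exp 4) * ∫⁻ z, g z ^ 2 * w z :=
        lintegral_const_mul _ ((hg.pow_const 2).mul hwm)
    _ ≤ ENNReal.ofReal (κ⁻¹ * Real.exp 4) * ∫⁻ z, ENNReal.ofReal (κ * Real.exp 8) *
          (ENNReal.ofReal (maxwellianProd β z) *
            ENNReal.ofReal (f (z 0).2 / maxwellian β (z 0).2) ^ 2) := by
        exact mul_le_mul' le_rfl (hcontr.trans (lintegral_mono hF))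
    _ = ENNReal.ofReal (κ⁻¹ * Real.exp 4) * (ENNReal.ofReal (κ * Real.exp 8) *
          ∫⁻ z : Fin (N + 1) → Phase d,
            ENNReal.ofReal (f (z 0).2 / maxwellian β (z 0).2) ^ 2 ∂maxwellMeasure d (N + 1) β) := by
        rw [lintegral_maxwellMeasure hrm']
        exact congrArg _ (lintegral_const_mul _ (hMm.mul hrm'))
    _ = _ := by
        rw [← mul_assoc, ← ENNReal.ofReal_mul (by positivity)]
        congr 1
        · congr 1
          rw [mul_mul_mul_comm, inv_mul_cancel₀ hκ.ne', one_mul, ← Real.exp_add]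
          norm_num
        · exact (measurePreserving_maxwellMeasure hβ (e := fun _ : Fin 1 => (0 : Fin (N + 1)))
            (Function.injective_of_subsingleton _)).lintegral_comp hrm

theorem gibbs_comp_perm (V : Torus d → ℝ) (z : Fin N → Phase d) (π : Equiv.Perm (Fin N)) :
    gibbs β V (z ∘ π) = gibbs β V z := by
  unfold gibbs gibbsWeight
  simp_rw [Finset.sum_erase_eq_sub (Finset.mem_univ _), Function.comp_apply]
  congr 3
  · congr 1
    exact Equiv.sum_comp π fun j => ‖(z j).2‖ ^ 2
  · congr 1
    rw [← Equiv.sum_comp π fun j => ∑ l, V ((z j).1 - (z l).1) - V ((z j).1 - (z j).1)]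
    exact Finset.sum_congr rfl fun j _ => by
      rw [Equiv.sum_comp π fun l => V ((z (π j)).1 - (z l).1)]

/-- The density at time `t` is symmetric in the labels of the background particles. -/
theorem rnDeriv_law_comp_perm (hV : IsPotential V) (hf : Measurable f) (ht : 0 ≤ t)
    {π : Equiv.Perm (Fin (N + 1))} (hπ : π 0 = 0) :
    (fun z => (law N β V f t).rnDeriv volume (z ∘ π)) =ᵐ[volume]
      (law N β V f t).rnDeriv volume := by
  set e : (Fin (N + 1) → Phase d) ≃ᵐ (Fin (N + 1) → Phase d) :=
    MeasurableEquiv.piCongrLeft (fun _ => Phase d) π.symm with he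
  have hez : ∀ z, e z = z ∘ π := by
    intro z
    ext1 j
    have := MeasurableEquiv.piCongrLeft_apply_apply (β := fun _ => Phase d) π.symm z (π j)
    simpa using this
  have hev : MeasurePreserving e volume volume :=
    volume_measurePreserving_piCongrLeft (fun _ => Phase d) π.symm
  have hF : ∀ z, initialDensity (N := N) β V f (z ∘ π) = initialDensity β V f z := by
    intro z
    obtain ⟨ρ, hρ⟩ : ∃ ρ : Equiv.Perm (Fin N), ∀ j, π j.succ = (ρ j).succ := by
      have hne : ∀ j : Fin N, π j.succ ≠ 0 := fun j h =>
        Fin.succ_ne_zero j (π.injective (h.trans hπ.symm))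
      have hinj : Function.Injective fun j : Fin N => (π j.succ).pred (hne j) := by
        intro i j hij
        exact Fin.succ_injective _ (π.injective (Fin.pred_inj.1 hij))
      exact ⟨Equiv.ofBijective _ (Finite.injective_iff_bijective.1 hinj), fun j => by simp⟩
    unfold initialDensity
    rw [Function.comp_apply, hπ]
    congr 1
    rw [← gibbs_comp_perm V (fun j => z j.succ) ρ]
    congr 1
    ext1 j
    simp only [Function.comp_apply, hρ]
  have hμ : Measure.map e (volume.withDensity fun z =>
      ENNReal.ofReal (initialDensity (N := N) β V f z)) =
      volume.withDensity fun z => ENNReal.ofReal (initialDensity (N := N) β V f z) := by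
    ext s hs
    rw [Measure.map_apply e.measurable hs, withDensity_apply _ (e.measurable hs),
      withDensity_apply _ hs, ← hev.setLIntegral_comp_preimage hs
        (measurable_initialDensity hV hf).ennreal_ofReal]
    simp_rw [hez, hF]
  have hΦ := measurable_newtonFlow (N := N) hV ht
  -- Relabelling commutes with the flow and leaves the initial law invariant. Uniqueness of
  -- densities then transfers the invariance to `g`, but only almost everywhere.
  have hlaw : Measure.map e (law N β V f t) = law N β V f t := by
    unfold law
    conv_rhs => rw [← hμ]
    rw [Measure.map_map e.measurable hΦ, Measure.map_map hΦ e.measurable]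
    congr 1
    ext1 z
    simp only [Function.comp_apply, hez, newtonFlow_comp_perm hV z ht π]
  have hac := law_absolutelyContinuous (N := N) (β := β) (f := f) hV ht
  have hgm := Measure.measurable_rnDeriv (law N β V f t) volume
  have hsf : SFinite (law N β V f t) := by unfold law; infer_instance
  set g := (law N β V f t).rnDeriv volume with hg
  have hge : (fun z => g (z ∘ π)) = g ∘ e := by
    ext z; rw [Function.comp_apply, hez]
  have hwd : volume.withDensity g = law N β V f t := Measure.withDensity_rnDeriv_eq _ _ hac
  rw [hge, ← withDensity_eq_iff_of_sigmaFinite (hgm.comp e.measurable).aemeasurable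
    hgm.aemeasurable]
  refine e.map_measurableEquiv_injective ?_
  rw [hwd, hlaw, ← hwd]
  ext s hs
  rw [Measure.map_apply e.measurable hs, withDensity_apply _ (e.measurable hs),
    withDensity_apply _ hs]
  exact hev.setLIntegral_comp_preimage hs hgm

end Law

/-! ### Partial integrals as commuting conditional expectations -/

section Lmarginal

open scoped ENNReal
open Function

variable {ι α : Type*} [DecidableEq ι] [MeasurableSpace α] {μ : Measure α}

theorem lmarginal_updateFinset (S : Finset ι) (F : (ι → α) → ℝ≥0∞) {T : Finset ι} (hT : T ⊆ S)
    (x : ι → α) (y : T → α) :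
    lmarginal (fun _ => μ) S F (updateFinset x T y) = lmarginal (fun _ => μ) S F x :=
  lmarginal_congr _ F fun i hi => by
    simp only [updateFinset_def]
    rw [dif_neg fun h => hi (hT h)]

theorem lmarginal_mul_of_updateFinset {T : Finset ι} {G F : (ι → α) → ℝ≥0∞} (hF : Measurable F)
    (hG : ∀ x y, G (updateFinset x T y) = G x) (x : ι → α) :
    lmarginal (fun _ => μ) T (fun x => G x * F x) x = G x * lmarginal (fun _ => μ) T F x := by
  simp only [lmarginal, hG]
  exact lintegral_const_mul _ (hF.comp measurable_updateFinset)

variable [IsProbabilityMeasure μ]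

theorem lmarginal_eq_self {T : Finset ι} {G : (ι → α) → ℝ≥0∞}
    (hG : ∀ x y, G (updateFinset x T y) = G x) : lmarginal (fun _ => μ) T G = G := by
  ext x
  simp [lmarginal, hG]

/-- Coordinates in `T ∩ S` are already integrated out, and integrating a constant against a
probability measure changes nothing. -/
theorem lmarginal_lmarginal (S T : Finset ι) {F : (ι → α) → ℝ≥0∞} (hF : Measurable F) :
    lmarginal (fun _ => μ) T (lmarginal (fun _ => μ) S F) = lmarginal (fun _ => μ) (S ∪ T) F := by
  have h1 : S ∪ T = (T \ S) ∪ S := by rw [Finset.sdiff_union_self_eq_union, Finset.union_comm]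
  have h2 : T = (T \ S) ∪ (T ∩ S) := (Finset.sdiff_union_inter T S).symm
  conv_lhs => rw [h2]
  rw [h1, lmarginal_union _ _ hF Finset.sdiff_disjoint,
    lmarginal_union _ _ (hF.lmarginal _) (Finset.disjoint_sdiff_inter T S),
    lmarginal_eq_self fun x y => lmarginal_updateFinset S F Finset.inter_subset_right x y]

variable [Fintype ι]

theorem lintegral_lmarginal (S : Finset ι) {F : (ι → α) → ℝ≥0∞} (hF : Measurable F) :
    ∫⁻ x, lmarginal (fun _ => μ) S F x ∂Measure.pi (fun _ => μ) =
      ∫⁻ x, F x ∂Measure.pi fun _ => μ :=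
  lintegral_eq_of_lmarginal_eq S (hF.lmarginal _) hF
    (lmarginal_eq_self fun x y => lmarginal_updateFinset S F subset_rfl x y)

theorem lintegral_mul_eq_lintegral_mul_lmarginal {T : Finset ι} {G F : (ι → α) → ℝ≥0∞}
    (hGm : Measurable G) (hF : Measurable F) (hG : ∀ x y, G (updateFinset x T y) = G x) :
    ∫⁻ x, G x * F x ∂Measure.pi (fun _ => μ) =
      ∫⁻ x, G x * lmarginal (fun _ => μ) T F x ∂Measure.pi (fun _ => μ) := by
  rw [← lintegral_lmarginal T (F := fun x => G x * F x) (hGm.mul hF)]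
  exact lintegral_congr fun x => lmarginal_mul_of_updateFinset hF hG x

/-- Averaging over `S` and over `T` are commuting orthogonal projections whose product averages over
`S ∪ T`. Each factor in turn is averaged over the coordinates on which the other does not depend. -/
theorem lintegral_lmarginal_mul_lmarginal (S T : Finset ι) {F : (ι → α) → ℝ≥0∞}
    (hF : Measurable F) :
    ∫⁻ x, lmarginal (fun _ => μ) S F x * lmarginal (fun _ => μ) T F x ∂Measure.pi (fun _ => μ) =
      ∫⁻ x, lmarginal (fun _ => μ) (S ∪ T) F x ^ 2 ∂Measure.pi (fun _ => μ) := by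
  have hm : ∀ S, Measurable (lmarginal (fun _ : ι => μ) S F) := fun S => hF.lmarginal _
  calc _ = ∫⁻ x, lmarginal (fun _ => μ) T F x * lmarginal (fun _ => μ) S F x
        ∂Measure.pi (fun _ => μ) := by simp_rw [mul_comm]
    _ = ∫⁻ x, lmarginal (fun _ => μ) T F x * lmarginal (fun _ => μ) (S ∪ T) F x
        ∂Measure.pi (fun _ => μ) := by
        rw [lintegral_mul_eq_lintegral_mul_lmarginal (hm T) (hm S)
          fun x y => lmarginal_updateFinset T F subset_rfl x y, lmarginal_lmarginal S T hF]
    _ = ∫⁻ x, lmarginal (fun _ => μ) (S ∪ T) F x * lmarginal (fun _ => μ) T F x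
        ∂Measure.pi (fun _ => μ) := by simp_rw [mul_comm]
    _ = _ := by
        rw [lintegral_mul_eq_lintegral_mul_lmarginal (hm (S ∪ T)) (hm T)
          fun x y => lmarginal_updateFinset (S ∪ T) F (T := S) Finset.subset_union_left x y,
          lmarginal_lmarginal T S hF, Finset.union_comm]
        simp_rw [pow_two]

theorem lintegral_sq_le_lintegral_sq {F : α → ℝ≥0∞} (hF : Measurable F) :
    (∫⁻ x, F x ∂μ) ^ 2 ≤ ∫⁻ x, F x ^ 2 ∂μ := by
  have h := ENNReal.lintegral_mul_le_Lp_mul_Lq μ Real.HolderConjugate.two_two hF.aemeasurable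
    (g := 1) aemeasurable_one
  simp only [Pi.mul_apply, Pi.one_apply, mul_one, ENNReal.one_rpow, lintegral_const,
    measure_univ] at h
  calc (∫⁻ x, F x ∂μ) ^ 2 ≤ ((∫⁻ x, F x ^ (2 : ℝ) ∂μ) ^ (1 / 2 : ℝ)) ^ 2 := by gcongr
    _ = ∫⁻ x, F x ^ 2 ∂μ := by
      rw [← ENNReal.rpow_natCast, ← ENNReal.rpow_mul]
      simp

theorem lintegral_lmarginal_sq_le (S : Finset ι) {F : (ι → α) → ℝ≥0∞} (hF : Measurable F) :
    ∫⁻ x, lmarginal (fun _ => μ) S F x ^ 2 ∂Measure.pi (fun _ => μ) ≤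
      ∫⁻ x, F x ^ 2 ∂Measure.pi fun _ => μ := by
  rw [← lintegral_lmarginal S (hF.pow_const 2)]
  exact lintegral_mono fun x =>
    lintegral_sq_le_lintegral_sq (hF.comp measurable_updateFinset)

/-- By Fubini, almost every fibre meets the exceptional set in a null set. -/
theorem lmarginal_congr_ae (S : Finset ι) {F G : (ι → α) → ℝ≥0∞} (hF : Measurable F)
    (hG : Measurable G) (h : F =ᵐ[Measure.pi fun _ => μ] G) :
    lmarginal (fun _ => μ) S F =ᵐ[Measure.pi fun _ => μ] lmarginal (fun _ => μ) S G := by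
  have hs : MeasurableSet {x | F x ≠ G x} := (measurableSet_eq_fun hF hG).compl
  set χ : (ι → α) → ℝ≥0∞ := {x | F x ≠ G x}.indicator 1 with hχ
  have hχm : Measurable χ := measurable_one.indicator hs
  have h0 : ∫⁻ x, lmarginal (fun _ => μ) S χ x ∂Measure.pi (fun _ => μ) = 0 := by
    rw [lintegral_lmarginal S hχm, hχ, lintegral_indicator_one hs]
    exact h
  filter_upwards [(lintegral_eq_zero_iff (hχm.lmarginal _)).1 h0] with x hx
  have hx' := (lintegral_eq_zero_iff (hχm.comp measurable_updateFinset)).1 hx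
  refine lintegral_congr_ae (hx'.mono fun y hy => ?_)
  by_contra hne
  simp [hχ, hne] at hy

end Lmarginal

/-! ### Marginals as conditional expectations of the relative density -/

section Marginals

open scoped ENNReal

variable {d N : ℕ} {β : ℝ} {D : (Fin (N + 1) → Phase d) → ℝ}

/-- The density relative to the tensorized Maxwellian, as an extended nonnegative function. -/
noncomputable def relDensity (β : ℝ) (D : (Fin (N + 1) → Phase d) → ℝ)
    (x : Fin (N + 1) → Phase d) : ℝ≥0∞ :=
  ENNReal.ofReal (D x / maxwellianProd β x)

theorem measurable_relDensity (hD : Measurable D) : Measurable (relDensity β D) :=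
  (hD.div measurable_maxwellianProd).ennreal_ofReal

/-- The concatenation of `z : Fin k → α` and `w : Fin (n - k) → α`. -/
def glue {α : Type*} {n k : ℕ} (z : Fin k → α) (w : Fin (n - k) → α) (i : Fin n) : α :=
  if h : (i : ℕ) < k then z ⟨i, h⟩ else w ⟨(i : ℕ) - k, by omega⟩

theorem measurable_glue {α : Type*} [MeasurableSpace α] {n k : ℕ} :
    Measurable fun p : (Fin k → α) × (Fin (n - k) → α) => glue p.1 p.2 := by
  refine measurable_pi_lambda _ fun i => ?_
  unfold glue
  split_ifs
  · exact (measurable_pi_apply _).comp measurable_fst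
  · exact (measurable_pi_apply _).comp measurable_snd

theorem maxwellianProd_glue {n k : ℕ} (hk : k ≤ n) (z : Fin k → Phase d)
    (w : Fin (n - k) → Phase d) :
    maxwellianProd β (glue z w) = maxwellianProd β z * maxwellianProd β w := by
  unfold maxwellianProd
  rw [← Equiv.prod_comp (finSumFinEquiv.trans (finCongr (Nat.add_sub_cancel' hk))),
    Fintype.prod_sum_type]
  congr 1 <;> refine Finset.prod_congr rfl fun i _ => ?_ <;> simp [glue]

theorem measurable_marginal (hD : Measurable D) (k : ℕ) : Measurable (marginal D k) := by
  have h : StronglyMeasurable fun p : (Fin k → Phase d) × (Fin (N + 1 - k) → Phase d) =>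
      D (glue p.1 p.2) := (hD.comp measurable_glue).stronglyMeasurable
  exact h.integral_prod_right.measurable

/-- The Maxwellian factorizes over the kept and the discarded particles: one factor cancels against
the denominator, the other becomes the integrating measure. -/
theorem marginal_castLE (hβ : 0 < β) (hD : Measurable D) (hD0 : ∀ x, 0 ≤ D x) {k : ℕ}
    (hk : k ≤ N + 1) (x : Fin (N + 1) → Phase d) :
    marginal D k (fun i => x (Fin.castLE hk i)) / maxwellianProd β (fun i => x (Fin.castLE hk i)) =
      (lmarginal (fun _ => maxwellPhase d β) (Finset.univ.filter fun i : Fin (N + 1) => k ≤ (i : ℕ))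
        (relDensity β D) x).toReal := by
  have := isProbabilityMeasure_maxwellPhase (d := d) hβ
  set S : Finset (Fin (N + 1)) := Finset.univ.filter fun i => k ≤ (i : ℕ) with hS
  set z : Fin k → Phase d := fun i => x (Fin.castLE hk i) with hz
  have hg : Measurable (fun w : Fin (N + 1 - k) → Phase d => glue (n := N + 1) z w) :=
    measurable_glue.comp ((measurable_const (a := z)).prodMk measurable_id)
  have hrel := measurable_relDensity (β := β) hD
  have h1 : marginal D k z = (∫⁻ w : Fin (N + 1 - k) → Phase d,
      ENNReal.ofReal (D (glue z w))).toReal :=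
    integral_eq_lintegral_of_nonneg_ae (ae_of_all _ fun w => hD0 _)
      (hD.comp hg).aestronglyMeasurable
  have h2 : ∀ w : Fin (N + 1 - k) → Phase d, ENNReal.ofReal (D (glue z w)) =
      ENNReal.ofReal (maxwellianProd β z) * (ENNReal.ofReal (maxwellianProd β w) *
        relDensity β D (glue z w)) := by
    intro w
    have hw := maxwellianProd_pos hβ w
    have hz' := maxwellianProd_pos hβ z
    rw [relDensity, ← ENNReal.ofReal_mul hw.le, ← ENNReal.ofReal_mul hz'.le,
      maxwellianProd_glue hk]
    congr 1
    field_simp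
  set e : S → Fin (N + 1 - k) := fun i => ⟨(i : Fin (N + 1)).1 - k, by
    have := (Finset.mem_filter.1 i.2).2
    omega⟩ with he
  have hej : Function.Injective e := by
    intro i j hij
    have hi := (Finset.mem_filter.1 i.2).2
    have hj := (Finset.mem_filter.1 j.2).2
    have : (i : Fin (N + 1)).1 - k = (j : Fin (N + 1)).1 - k := congrArg Fin.val hij
    exact Subtype.ext (Fin.ext (by omega))
  have h3 : ∫⁻ w, relDensity β D (glue z w) ∂maxwellMeasure d (N + 1 - k) β =
      lmarginal (fun _ => maxwellPhase d β) S (relDensity β D) x := by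
    rw [maxwellMeasure_eq_pi hβ, lmarginal, ← (measurePreserving_comp_injective hej).lintegral_comp
      (f := fun y => relDensity β D (Function.updateFinset x S y))
      (hrel.comp measurable_updateFinset)]
    refine lintegral_congr fun w => ?_
    congr 1
    ext1 i
    by_cases hi : (i : ℕ) < k
    · have : i ∉ S := by simp [hS, hi]
      simp [glue, hi, Function.updateFinset_def, this, hz]
    · have : i ∈ S := by simp [hS]; omega
      simp [glue, hi, Function.updateFinset_def, this, he]
  rw [h1, lintegral_congr h2, lintegral_const_mul _ (by
      exact measurable_maxwellianProd.ennreal_ofReal.mul (hrel.comp hg)),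
    ← lintegral_maxwellMeasure (G := fun w => relDensity β D (glue z w)) (hrel.comp hg), h3,
    ENNReal.toReal_mul, ENNReal.toReal_ofReal (maxwellianProd_pos hβ z).le,
    mul_div_cancel_left₀ _ (maxwellianProd_pos hβ z).ne']

/-- The marginal of order `k` relative to the Maxwellian. -/
noncomputable def relMarginal (β : ℝ) (D : (Fin (N + 1) → Phase d) → ℝ) (k : ℕ)
    (z : Fin k → Phase d) : ℝ :=
  marginal D k z / maxwellianProd β z

theorem measurable_relMarginal (hD : Measurable D) (k : ℕ) : Measurable (relMarginal β D k) :=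
  (measurable_marginal hD k).div measurable_maxwellianProd

/-- A permutation fixing `0` carries the first `k + 1` labels to the range of `e`, so symmetry of
`D` reduces the claim to `marginal_castLE`. -/
theorem relMarginal_comp_ae_eq (hβ : 0 < β) (hD : Measurable D) (hD0 : ∀ x, 0 ≤ D x)
    (hsym : ∀ π : Equiv.Perm (Fin (N + 1)), π 0 = 0 →
      (fun x => D (x ∘ π)) =ᵐ[volume] D) {k : ℕ}
    {e : Fin (k + 1) → Fin (N + 1)} (he : Function.Injective e) (he0 : e 0 = 0) :
    (fun x => relMarginal β D (k + 1) (fun i => x (e i))) =ᵐ[maxwellMeasure d (N + 1) β]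
      fun x => (lmarginal (fun _ => maxwellPhase d β) (Finset.univ.image e)ᶜ
        (relDensity β D) x).toReal := by
  have := isProbabilityMeasure_maxwellPhase (d := d) hβ
  have hk : k + 1 ≤ N + 1 := by simpa using Fintype.card_le_of_injective e he
  have hrel := measurable_relDensity (β := β) hD
  obtain ⟨π, hπ⟩ := Equiv.Perm.exists_extending_pair (Fin.castLE hk) e
    (Fin.castLE_injective hk) he
  have hπe : ∀ i, π (Fin.castLE hk i) = e i := fun i => by simp [hπ]
  have hπ0 : π 0 = 0 := (hπe 0).trans he0
  set S : Finset (Fin (N + 1)) := Finset.univ.filter fun i => k + 1 ≤ (i : ℕ) with hS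
  have himage : S.image π = (Finset.univ.image e)ᶜ := by
    ext i
    obtain ⟨j, rfl⟩ := π.surjective i
    simp only [Finset.mem_image, EmbeddingLike.apply_eq_iff_eq, exists_eq_right, Finset.mem_compl,
      Finset.mem_univ, true_and, ← hπe, hS, Finset.mem_filter]
    refine ⟨fun h ⟨i, hi⟩ => ?_, fun h => ?_⟩
    · have := congrArg Fin.val hi
      simp only [Fin.val_castLE] at this
      omega
    · by_contra hj
      exact h ⟨⟨j, by omega⟩, Fin.ext rfl⟩
  have hP : maxwellMeasure d (N + 1) β ≪ volume := withDensity_absolutelyContinuous _ _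
  have hrelsym : (fun x => relDensity β D (x ∘ π)) =ᵐ[Measure.pi fun _ => maxwellPhase d β]
      relDensity β D := by
    rw [← maxwellMeasure_eq_pi hβ]
    filter_upwards [hP (hsym π hπ0)] with x hx
    have : maxwellianProd β (x ∘ π) = maxwellianProd β x :=
      Equiv.prod_comp π fun j => maxwellian β (x j).2
    rw [relDensity, relDensity, this, hx]
  have hcomp : Measurable fun x : Fin (N + 1) → Phase d => x ∘ π :=
    measurable_pi_lambda _ fun i => measurable_pi_apply _
  have h := lmarginal_congr_ae (S.image π) (hrel.comp hcomp) hrel hrelsym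
  rw [maxwellMeasure_eq_pi hβ]
  filter_upwards [h] with x hx
  rw [← himage, ← hx]
  have h4 := lmarginal_image (X := fun _ => Phase d) (μ := fun _ => maxwellPhase d β) π.injective S hrel x
  have h5 := marginal_castLE hβ hD hD0 hk (x ∘ π)
  simp only [Function.comp_apply, hπe] at h5
  rw [relMarginal, h5]
  exact congrArg ENNReal.toReal h4.symm

/-- The labels of the particles occurring in `select z σ`. -/
def selectIndex {m : ℕ} (σ : Finset (Fin m)) : Fin (σ.card + 1) → Fin (m + 1) :=
  Fin.cons 0 fun i => (σ.orderEmbOfFin rfl i).succ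

theorem select_eq {m : ℕ} (z : Fin (m + 1) → Phase d) (σ : Finset (Fin m)) :
    select z σ = fun i => z (selectIndex σ i) := by
  ext1 i
  refine Fin.cases ?_ (fun i => ?_) i <;> simp [select, selectIndex]

theorem selectIndex_injective {m : ℕ} (σ : Finset (Fin m)) :
    Function.Injective (selectIndex σ) := by
  refine Fin.cons_injective_iff.2 ⟨?_, ?_⟩
  · rintro ⟨i, hi⟩
    exact Fin.succ_ne_zero _ hi
  · exact (Fin.succ_injective _).comp (σ.orderEmbOfFin rfl).injective

theorem image_selectIndex {m : ℕ} (σ : Finset (Fin m)) :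
    Finset.univ.image (selectIndex σ) = insert 0 (σ.map (Fin.succEmb m)) := by
  apply Finset.coe_injective
  rw [Finset.coe_image, Finset.coe_univ, Set.image_univ, selectIndex, Fin.range_cons,
    Finset.coe_insert, Finset.coe_map, ← Finset.range_orderEmbOfFin σ rfl, ← Set.range_comp]
  rfl

theorem image_selectIndex_compl {m : ℕ} (σ : Finset (Fin m)) :
    (Finset.univ.image (selectIndex σ))ᶜ = σᶜ.map (Fin.succEmb m) := by
  rw [image_selectIndex]
  ext i
  refine Fin.cases ?_ (fun i => ?_) i <;> simp [Fin.succ_ne_zero]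

end Marginals

/-! ### Cumulants as Hoeffding components -/

section Cumulants

open scoped ENNReal

variable {d N : ℕ} {β : ℝ} {D : (Fin (N + 1) → Phase d) → ℝ}

/-- The relative density with the background particles outside `σ` averaged out, as a function of
all particles. -/
noncomputable def averagedDensity (β : ℝ) (D : (Fin (N + 1) → Phase d) → ℝ) (σ : Finset (Fin N)) :
    (Fin (N + 1) → Phase d) → ℝ≥0∞ :=
  lmarginal (fun _ => maxwellPhase d β) (σᶜ.map (Fin.succEmb N)) (relDensity β D)

theorem measurable_averagedDensity (hβ : 0 < β) (hD : Measurable D) (σ : Finset (Fin N)) :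
    Measurable (averagedDensity β D σ) := by
  have := isProbabilityMeasure_maxwellPhase (d := d) hβ
  exact (measurable_relDensity hD).lmarginal _

theorem lintegral_averagedDensity_mul (hβ : 0 < β) (hD : Measurable D) (σ τ : Finset (Fin N)) :
    ∫⁻ x, averagedDensity β D σ x * averagedDensity β D τ x ∂maxwellMeasure d (N + 1) β =
      ∫⁻ x, averagedDensity β D (σ ∩ τ) x ^ 2 ∂maxwellMeasure d (N + 1) β := by
  have := isProbabilityMeasure_maxwellPhase (d := d) hβ
  rw [maxwellMeasure_eq_pi hβ]
  unfold averagedDensity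
  rw [lintegral_lmarginal_mul_lmarginal _ _ (measurable_relDensity hD), Finset.compl_inter,
    Finset.map_union]

theorem lintegral_averagedDensity_sq_le (hβ : 0 < β) (hD : Measurable D) (σ : Finset (Fin N)) :
    ∫⁻ x, averagedDensity β D σ x ^ 2 ∂maxwellMeasure d (N + 1) β ≤
      ∫⁻ x, relDensity β D x ^ 2 ∂maxwellMeasure d (N + 1) β := by
  have := isProbabilityMeasure_maxwellPhase (d := d) hβ
  rw [maxwellMeasure_eq_pi hβ]
  exact lintegral_lmarginal_sq_le _ (measurable_relDensity hD)

theorem averagedDensity_univ : averagedDensity β D Finset.univ = relDensity β D := by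
  simp [averagedDensity]

theorem averagedDensity_ae_ne_top (hβ : 0 < β) (hD : Measurable D)
    (hfin : ∫⁻ x, relDensity β D x ^ 2 ∂maxwellMeasure d (N + 1) β ≠ ∞) (σ : Finset (Fin N)) :
    ∀ᵐ x ∂maxwellMeasure d (N + 1) β, averagedDensity β D σ x ≠ ∞ := by
  filter_upwards [ae_lt_top ((measurable_averagedDensity hβ hD σ).pow_const 2)
    (ne_top_of_le_ne_top hfin (lintegral_averagedDensity_sq_le hβ hD σ))] with x hx h
  simp [h] at hx

/-- The right side sees `σ` only through its cardinality; this is the function `b` of the abstract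
decomposition. -/
theorem lintegral_averagedDensity_sq (hβ : 0 < β) (hD : Measurable D) (hD0 : ∀ x, 0 ≤ D x)
    (hsym : ∀ π : Equiv.Perm (Fin (N + 1)), π 0 = 0 →
      (fun x => D (x ∘ π)) =ᵐ[volume] D)
    (hfin : ∫⁻ x, relDensity β D x ^ 2 ∂maxwellMeasure d (N + 1) β ≠ ∞) (σ : Finset (Fin N)) :
    ∫⁻ x, averagedDensity β D σ x ^ 2 ∂maxwellMeasure d (N + 1) β =
      ∫⁻ z, ENNReal.ofReal (relMarginal β D (σ.card + 1) z) ^ 2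
        ∂maxwellMeasure d (σ.card + 1) β := by
  rw [← (measurePreserving_maxwellMeasure hβ (selectIndex_injective σ)).lintegral_comp
    ((measurable_relMarginal hD _).ennreal_ofReal.pow_const 2)]
  refine lintegral_congr_ae ?_
  filter_upwards [relMarginal_comp_ae_eq hβ hD hD0 hsym (selectIndex_injective σ) rfl,
    averagedDensity_ae_ne_top hβ hD hfin σ] with x hx hx'
  rw [image_selectIndex_compl] at hx
  simp only [hx]
  rw [ENNReal.ofReal_toReal]
  · rfl
  · exact hx'

theorem memLp_averagedDensity (hβ : 0 < β) (hD : Measurable D)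
    (hfin : ∫⁻ x, relDensity β D x ^ 2 ∂maxwellMeasure d (N + 1) β ≠ ∞) (σ : Finset (Fin N)) :
    MemLp (fun x => (averagedDensity β D σ x).toReal) 2 (maxwellMeasure d (N + 1) β) := by
  refine ⟨(measurable_averagedDensity hβ hD σ).ennreal_toReal.aestronglyMeasurable, ?_⟩
  rw [eLpNorm_lt_top_iff_lintegral_rpow_enorm_lt_top two_ne_zero ENNReal.ofNat_ne_top]
  refine lt_of_le_of_lt (lintegral_mono fun x => ?_)
    ((lintegral_averagedDensity_sq_le hβ hD σ).trans_lt hfin.lt_top)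
  rw [ENNReal.toReal_ofNat, ENNReal.rpow_ofNat]
  gcongr
  rw [Real.enorm_of_nonneg ENNReal.toReal_nonneg]
  exact ENNReal.ofReal_toReal_le

/-- The averaged relative density as an element of `L²`. -/
noncomputable def averagedDensityLp (hβ : 0 < β) (hD : Measurable D)
    (hfin : ∫⁻ x, relDensity β D x ^ 2 ∂maxwellMeasure d (N + 1) β ≠ ∞) (σ : Finset (Fin N)) :
    Lp ℝ 2 (maxwellMeasure d (N + 1) β) :=
  (memLp_averagedDensity hβ hD hfin σ).toLp _

theorem inner_averagedDensityLp (hβ : 0 < β) (hD : Measurable D)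
    (hfin : ∫⁻ x, relDensity β D x ^ 2 ∂maxwellMeasure d (N + 1) β ≠ ∞) (σ τ : Finset (Fin N)) :
    inner ℝ (averagedDensityLp hβ hD hfin σ) (averagedDensityLp hβ hD hfin τ) =
      (∫⁻ x, averagedDensity β D (σ ∩ τ) x ^ 2 ∂maxwellMeasure d (N + 1) β).toReal := by
  have hm := measurable_averagedDensity hβ hD
  rw [L2.inner_def, ← lintegral_averagedDensity_mul hβ hD, ← integral_toReal
    (f := fun x => averagedDensity β D σ x * averagedDensity β D τ x)
    ((hm σ).mul (hm τ)).aemeasurable]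
  · refine integral_congr_ae ?_
    filter_upwards [(memLp_averagedDensity hβ hD hfin σ).coeFn_toLp,
      (memLp_averagedDensity hβ hD hfin τ).coeFn_toLp] with x hσ hτ
    simp only [averagedDensityLp, hσ, hτ, ENNReal.toReal_mul, real_inner_eq_re_inner]
    simp [mul_comm]
  · filter_upwards [averagedDensity_ae_ne_top hβ hD hfin σ,
      averagedDensity_ae_ne_top hβ hD hfin τ] with x h1 h2
    exact (ENNReal.mul_ne_top h1 h2).lt_top

theorem choose_mul_norm_alternatingSum_averagedDensityLp_sq_le (hβ : 0 < β) (hD : Measurable D)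
    (hD0 : ∀ x, 0 ≤ D x)
    (hsym : ∀ π : Equiv.Perm (Fin (N + 1)), π 0 = 0 →
      (fun x => D (x ∘ π)) =ᵐ[volume] D)
    (hfin : ∫⁻ x, relDensity β D x ^ 2 ∂maxwellMeasure d (N + 1) β ≠ ∞) (σ : Finset (Fin N)) :
    (N.choose σ.card : ℝ) * ‖alternatingSum (averagedDensityLp hβ hD hfin) σ‖ ^ 2 ≤
      (∫⁻ x, relDensity β D x ^ 2 ∂maxwellMeasure d (N + 1) β).toReal := by
  have h := choose_mul_norm_alternatingSum_sq_le (A := averagedDensityLp hβ hD hfin)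
    (b := fun k => (∫⁻ z, ENNReal.ofReal (relMarginal β D (k + 1) z) ^ 2
        ∂maxwellMeasure d (k + 1) β).toReal) (fun σ τ => by
      rw [inner_averagedDensityLp, lintegral_averagedDensity_sq hβ hD hD0 hsym hfin]) σ
  rwa [Fintype.card_fin, ← real_inner_self_eq_norm_sq (averagedDensityLp hβ hD hfin Finset.univ),
    inner_averagedDensityLp, Finset.inter_self, averagedDensity_univ] at h

theorem measurable_cumulant (hD : Measurable D) (m : ℕ) : Measurable (cumulant β D m) := by
  refine Finset.measurable_fun_sum _ fun σ _ => measurable_const.mul ?_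
  simp only [select_eq]
  exact (measurable_relMarginal hD _).comp
    (measurable_pi_lambda _ fun i => measurable_pi_apply _)

/-- Lifted to the full phase space, the cumulant is the Hoeffding component of the first `m`
background labels. -/
theorem cumulant_comp_castLE_ae_eq (hβ : 0 < β) (hD : Measurable D) (hD0 : ∀ x, 0 ≤ D x)
    (hsym : ∀ π : Equiv.Perm (Fin (N + 1)), π 0 = 0 →
      (fun x => D (x ∘ π)) =ᵐ[volume] D)
    (hfin : ∫⁻ x, relDensity β D x ^ 2 ∂maxwellMeasure d (N + 1) β ≠ ∞) {m : ℕ} (hm : m ≤ N) :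
    (fun x => cumulant β D m fun i => x (Fin.castLE (Nat.succ_le_succ hm) i))
      =ᵐ[maxwellMeasure d (N + 1) β]
      (alternatingSum (averagedDensityLp hβ hD hfin)
        (Finset.univ.map (Fin.castLEEmb hm)) : Lp ℝ 2 (maxwellMeasure d (N + 1) β)) := by
  have h1 : alternatingSum (averagedDensityLp hβ hD hfin) (Finset.univ.map (Fin.castLEEmb hm)) =
      ∑ σ : Finset (Fin m), (-1 : ℝ) ^ (m - σ.card) •
        averagedDensityLp hβ hD hfin (σ.map (Fin.castLEEmb hm)) := by
    symm
    refine Finset.sum_nbij (fun σ => σ.map (Fin.castLEEmb hm)) (fun σ _ => ?_)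
      (fun σ _ τ _ h => Finset.map_injective _ h) (fun ρ hρ => ?_) (fun σ _ => ?_)
    · exact Finset.mem_powerset.2 (Finset.map_subset_map.2 (Finset.subset_univ σ))
    · obtain ⟨σ, _, rfl⟩ := Finset.subset_map_iff.1 (Finset.mem_powerset.1 hρ)
      exact ⟨σ, Finset.mem_coe.2 (Finset.mem_univ σ), rfl⟩
    · simp
  have h2 : ∀ σ : Finset (Fin m), (fun x : Fin (N + 1) → Phase d => relMarginal β D (σ.card + 1)
      (select (fun i => x (Fin.castLE (Nat.succ_le_succ hm) i)) σ))
      =ᵐ[maxwellMeasure d (N + 1) β]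
      averagedDensityLp hβ hD hfin (σ.map (Fin.castLEEmb hm)) := by
    intro σ
    have hinj : Function.Injective fun i =>
        Fin.castLE (Nat.succ_le_succ hm) (selectIndex σ i) :=
      (Fin.castLE_injective _).comp (selectIndex_injective σ)
    have himage : (Finset.univ.image fun i =>
        Fin.castLE (Nat.succ_le_succ hm) (selectIndex σ i)) =
        Finset.univ.image (selectIndex (σ.map (Fin.castLEEmb hm))) := by
      have hcomp : (fun i => Fin.castLE (Nat.succ_le_succ hm) (selectIndex σ i)) =
          Fin.castLE (Nat.succ_le_succ hm) ∘ selectIndex σ := rfl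
      rw [hcomp, ← Finset.image_image, image_selectIndex, image_selectIndex, Finset.image_insert,
        Finset.map_eq_image, Finset.map_eq_image, Finset.map_eq_image, Finset.image_image,
        Finset.image_image]
      rfl
    filter_upwards [relMarginal_comp_ae_eq hβ hD hD0 hsym hinj rfl,
      (memLp_averagedDensity hβ hD hfin (σ.map (Fin.castLEEmb hm))).coeFn_toLp] with x hx hx'
    rw [himage, image_selectIndex_compl] at hx
    rw [select_eq, averagedDensityLp, hx', hx]
    rfl
  rw [h1]
  have h3 : ∀ᵐ x ∂maxwellMeasure d (N + 1) β, ∀ σ : Finset (Fin m),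
      relMarginal β D (σ.card + 1) (select (fun i => x (Fin.castLE (Nat.succ_le_succ hm) i)) σ) =
      averagedDensityLp hβ hD hfin (σ.map (Fin.castLEEmb hm)) x := ae_all_iff.2 h2
  have h4 : ∀ᵐ x ∂maxwellMeasure d (N + 1) β, ∀ σ : Finset (Fin m),
      ((-1 : ℝ) ^ (m - σ.card) • averagedDensityLp hβ hD hfin (σ.map (Fin.castLEEmb hm)) :
        Lp ℝ 2 (maxwellMeasure d (N + 1) β)) x = (-1 : ℝ) ^ (m - σ.card) *
        averagedDensityLp hβ hD hfin (σ.map (Fin.castLEEmb hm)) x :=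
    ae_all_iff.2 fun σ => Lp.coeFn_smul _ _
  filter_upwards [h3, h4, Lp.coeFn_fun_finsetSum Finset.univ fun σ : Finset (Fin m) =>
    (-1 : ℝ) ^ (m - σ.card) • averagedDensityLp hβ hD hfin (σ.map (Fin.castLEEmb hm))]
    with x h3 h4 h5
  rw [h5]
  exact Finset.sum_congr rfl fun σ _ => by rw [h4, ← h3]; rfl

/-- The cumulant of order `m + 1` is `O(N^{-m/2})` in `L²_β`, by orthogonality of the cumulants. -/
theorem memLp_cumulant_and_choose_mul_eLpNorm_sq_le (hβ : 0 < β) (hD : Measurable D)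
    (hD0 : ∀ x, 0 ≤ D x)
    (hsym : ∀ π : Equiv.Perm (Fin (N + 1)), π 0 = 0 →
      (fun x => D (x ∘ π)) =ᵐ[volume] D)
    (hfin : ∫⁻ x, relDensity β D x ^ 2 ∂maxwellMeasure d (N + 1) β ≠ ∞) {m : ℕ} (hm : m ≤ N) :
    MemLp (cumulant β D m) 2 (maxwellMeasure d (m + 1) β) ∧
      (N.choose m : ℝ) * (eLpNorm (cumulant β D m) 2 (maxwellMeasure d (m + 1) β)).toReal ^ 2 ≤
        (∫⁻ x, relDensity β D x ^ 2 ∂maxwellMeasure d (N + 1) β).toReal := by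
  have hae := cumulant_comp_castLE_ae_eq hβ hD hD0 hsym hfin hm
  have hmp := measurePreserving_maxwellMeasure (d := d) hβ
    (Fin.castLE_injective (Nat.succ_le_succ hm))
  have hmeas := (measurable_cumulant (β := β) hD m).aestronglyMeasurable
    (μ := maxwellMeasure d (m + 1) β)
  -- The lift composes with a measure-preserving projection, so the norm on `𝔻^{m+1}` can be
  -- computed on `𝔻^{N+1}`.
  have hnorm := eLpNorm_comp_measurePreserving (p := 2) hmeas hmp
  have hnorm' := (eLpNorm_congr_ae (p := 2) hae).symm.trans hnorm
  have h := choose_mul_norm_alternatingSum_averagedDensityLp_sq_le hβ hD hD0 hsym hfin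
    (Finset.univ.map (Fin.castLEEmb hm))
  rw [Finset.card_map, Finset.card_univ, Fintype.card_fin, Lp.norm_def, hnorm'] at h
  refine ⟨⟨hmeas, ?_⟩, h⟩
  rw [← hnorm']
  exact Lp.eLpNorm_lt_top _

end Cumulants

/-! ### From binomial coefficients to powers of `N` -/

section Estimate

open scoped ENNReal

theorem pow_le_mul_choose {m N : ℕ} (hm : m ≤ N) :
    N ^ m ≤ m ^ m * m.factorial * N.choose m := by
  rcases Nat.eq_zero_or_pos m with rfl | hm0
  · simp
  -- Writing `N = m + k`, this is `m + k ≤ m * (k + 1)`; each of the `m` factors of the descending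
  -- factorial is at least `N + 1 - m`.
  have h1 : N ≤ m * (N + 1 - m) := by
    obtain ⟨k, rfl⟩ := Nat.exists_eq_add_of_le hm
    rw [show m + k + 1 - m = k + 1 by omega, mul_add, mul_one]
    nlinarith
  calc N ^ m ≤ (m * (N + 1 - m)) ^ m := Nat.pow_le_pow_left h1 m
    _ = m ^ m * (N + 1 - m) ^ m := mul_pow _ _ _
    _ ≤ m ^ m * N.descFactorial m := Nat.mul_le_mul_left _ (Nat.pow_sub_le_descFactorial N m)
    _ = m ^ m * m.factorial * N.choose m := by
      rw [Nat.descFactorial_eq_factorial_mul_choose, mul_assoc]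

theorem le_sqrt_mul_rpow_of_choose_mul_sq_le {m N : ℕ} (hN : 1 ≤ N) (hm : m ≤ N) {K x y : ℝ}
    (hK : 0 ≤ K) (hy : 0 ≤ y) (h : (N.choose m : ℝ) * x ^ 2 ≤ K * y ^ 2) :
    x ≤ √(K * (m ^ m * m.factorial)) * (N : ℝ) ^ (-(m : ℝ) / 2) * y := by
  have hN0 : (0 : ℝ) < N := by exact_mod_cast hN
  refine le_of_sq_le_sq ?_ (by positivity)
  have h1 : ((N : ℝ) ^ (-(m : ℝ) / 2)) ^ 2 = ((N : ℝ) ^ m)⁻¹ := by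
    rw [← Real.rpow_natCast, ← Real.rpow_mul hN0.le, ← Real.rpow_natCast, ← Real.rpow_neg hN0.le]
    congr 1
    push_cast
    ring
  rw [mul_pow, mul_pow, Real.sq_sqrt (by positivity), h1]
  have h2 : (N : ℝ) ^ m ≤ m ^ m * m.factorial * N.choose m := by
    exact_mod_cast pow_le_mul_choose hm
  have h3 : (N : ℝ) ^ m * x ^ 2 ≤ K * (m ^ m * m.factorial) * y ^ 2 :=
    calc (N : ℝ) ^ m * x ^ 2 ≤ (m ^ m * m.factorial * N.choose m) * x ^ 2 := by gcongr
      _ = (m ^ m * m.factorial) * (N.choose m * x ^ 2) := by ring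
      _ ≤ (m ^ m * m.factorial) * (K * y ^ 2) := by gcongr
      _ = _ := by ring
  have hNm : (0 : ℝ) < (N : ℝ) ^ m := by positivity
  rw [mul_right_comm, ← div_eq_mul_inv, le_div_iff₀ hNm, mul_comm]
  exact h3

variable {d N : ℕ} {β : ℝ} {V : Torus d → ℝ} {f : Vel d → ℝ} {t : ℝ}

theorem measurable_density : Measurable (density N β V f t) :=
  (Measure.measurable_rnDeriv _ _).ennreal_toReal

theorem density_nonneg (x : Fin (N + 1) → Phase d) : 0 ≤ density N β V f t x :=
  ENNReal.toReal_nonneg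

theorem density_comp_perm (hV : IsPotential V) (hf : Measurable f) (ht : 0 ≤ t)
    {π : Equiv.Perm (Fin (N + 1))} (hπ : π 0 = 0) :
    (fun x => density N β V f t (x ∘ π)) =ᵐ[volume] density N β V f t :=
  (rnDeriv_law_comp_perm hV hf ht hπ).mono fun _ hx => congrArg ENNReal.toReal hx

/-- Squaring the relative density and integrating against the Maxwellian leaves one inverse
Maxwellian, the weight of `lintegral_rnDeriv_law_sq_le`. -/
theorem lintegral_relDensity_density_sq_le (hV : IsPotential V) (hβ : 0 < β)
    (hVβ : β * (eLpNorm V ⊤ volume).toReal ≤ 2) (hN : 1 ≤ N) (hf : Measurable f)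
    (hf0 : ∀ v, 0 ≤ f v) (ht : 0 ≤ t) :
    ∫⁻ x, relDensity β (density N β V f t) x ^ 2 ∂maxwellMeasure d (N + 1) β ≤
      ENNReal.ofReal (Real.exp 12) * eLpNorm (fun z : Fin 1 → Phase d =>
        f (z 0).2 / maxwellian β (z 0).2) 2 (maxwellMeasure d 1 β) ^ 2 := by
  have h1 : eLpNorm (fun z : Fin 1 → Phase d => f (z 0).2 / maxwellian β (z 0).2) 2
      (maxwellMeasure d 1 β) ^ 2 = ∫⁻ z : Fin 1 → Phase d,
        ENNReal.ofReal (f (z 0).2 / maxwellian β (z 0).2) ^ 2 ∂maxwellMeasure d 1 β := by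
    have := eLpNorm_nnreal_pow_eq_lintegral (p := 2) (μ := maxwellMeasure d 1 β)
      (f := fun z : Fin 1 → Phase d => f (z 0).2 / maxwellian β (z 0).2) two_ne_zero
    simp only [NNReal.coe_ofNat, ENNReal.coe_ofNat, ENNReal.rpow_ofNat] at this
    rw [this]
    refine lintegral_congr fun z => ?_
    rw [Real.enorm_of_nonneg (div_nonneg (hf0 _) (maxwellian_pos hβ _).le)]
  rw [h1]
  refine le_trans ?_ (lintegral_rnDeriv_law_sq_le hV hβ hVβ hN hf hf0 ht)
  rw [lintegral_maxwellMeasure ((measurable_relDensity measurable_density).pow_const 2)]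
  refine lintegral_mono fun x => ?_
  have hM := maxwellianProd_pos hβ x
  have hM0 : ENNReal.ofReal (maxwellianProd β x) ≠ 0 := by simpa using hM
  rw [relDensity, ENNReal.ofReal_div_of_pos hM, div_eq_mul_inv, mul_pow, mul_left_comm,
    pow_two (ENNReal.ofReal (maxwellianProd β x))⁻¹, ← mul_assoc (ENNReal.ofReal _),
    ENNReal.mul_inv_cancel hM0 ENNReal.ofReal_ne_top, one_mul]
  gcongr
  exact ENNReal.ofReal_toReal_le

end Estimate
end TaggedParticle

/-! ### The cumulant estimate -/

theorem lemma2p2 (d : ℕ) (hd : 1 ≤ d) (β : ℝ) (hβ : 0 < β) (q : ℝ) (hq : 1 < q) (m : ℕ) :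
    ∃ C : ℝ, 0 < C ∧
      ∀ V : TaggedParticle.Torus d → ℝ, TaggedParticle.IsPotential V →
      β * (eLpNorm V ⊤ volume).toReal < 4 * (q - 1) / (2 * q - 1) →
      ∀ f : TaggedParticle.Vel d → ℝ, Measurable f → (∀ v, 0 ≤ f v) → ∫ v, f v = 1 →
      MemLp (fun z : Fin 1 → TaggedParticle.Phase d =>
          f (z 0).2 / TaggedParticle.maxwellian β (z 0).2)
        (ENNReal.ofReal (2 * q)) (TaggedParticle.maxwellMeasure d 1 β) →
      ∀ N : ℕ, 1 ≤ N → m ≤ N → ∀ t : ℝ, 0 ≤ t →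
        TaggedParticle.law N β V f t ≪ volume ∧
        MemLp (TaggedParticle.cumulant β (TaggedParticle.density N β V f t) m) 2
          (TaggedParticle.maxwellMeasure d (m + 1) β) ∧
        (eLpNorm (TaggedParticle.cumulant β (TaggedParticle.density N β V f t) m) 2
            (TaggedParticle.maxwellMeasure d (m + 1) β)).toReal
          ≤ C * (N : ℝ) ^ (-(m : ℝ) / 2) *
            (eLpNorm (fun z : Fin 1 → TaggedParticle.Phase d =>
                f (z 0).2 / TaggedParticle.maxwellian β (z 0).2)
              (ENNReal.ofReal (2 * q)) (TaggedParticle.maxwellMeasure d 1 β)).toReal := by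
  -- For `m = 0` the convention `0 ^ 0 = 1` keeps the constant positive.
  have hmm : (0 : ℝ) < (m : ℝ) ^ m := by
    rcases Nat.eq_zero_or_pos m with rfl | h
    · simp
    · positivity
  refine ⟨√(Real.exp 12 * (m ^ m * m.factorial)), by positivity, ?_⟩
  intro V hV hVq f hf hf0 _ hfL N hN hm t ht
  have hVβ : β * (eLpNorm V ⊤ volume).toReal ≤ 2 := by
    refine hVq.le.trans ?_
    rw [div_le_iff₀ (by linarith)]
    linarith
  have := TaggedParticle.isProbabilityMeasure_maxwellMeasure (d := d) hβ 1
  -- On a probability space the norms increase with the exponent, and `2 ≤ 2 * q`.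
  have hexp : eLpNorm (fun z : Fin 1 → TaggedParticle.Phase d =>
      f (z 0).2 / TaggedParticle.maxwellian β (z 0).2) 2 (TaggedParticle.maxwellMeasure d 1 β) ≤
      eLpNorm (fun z : Fin 1 → TaggedParticle.Phase d =>
        f (z 0).2 / TaggedParticle.maxwellian β (z 0).2) (ENNReal.ofReal (2 * q))
        (TaggedParticle.maxwellMeasure d 1 β) := by
    refine eLpNorm_le_eLpNorm_of_exponent_le ?_ hfL.aestronglyMeasurable
    rw [← ENNReal.ofReal_ofNat]
    exact ENNReal.ofReal_le_ofReal (by linarith)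
  have hle := (TaggedParticle.lintegral_relDensity_density_sq_le hV hβ hVβ hN hf hf0 ht).trans
    (mul_le_mul_right (pow_le_pow_left' hexp 2) _)
  have hrhs := ENNReal.mul_ne_top (ENNReal.ofReal_ne_top (r := Real.exp 12))
    (ENNReal.pow_ne_top (n := 2) hfL.eLpNorm_lt_top.ne)
  have hfin := ne_top_of_le_ne_top hrhs hle
  obtain ⟨hmem, hbound⟩ := TaggedParticle.memLp_cumulant_and_choose_mul_eLpNorm_sq_le hβ
    TaggedParticle.measurable_density TaggedParticle.density_nonneg
    (fun π hπ => TaggedParticle.density_comp_perm hV hf ht hπ) hfin hm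
  refine ⟨TaggedParticle.law_absolutelyContinuous hV ht, hmem, ?_⟩
  refine TaggedParticle.le_sqrt_mul_rpow_of_choose_mul_sq_le hN hm (Real.exp_pos _).le
    ENNReal.toReal_nonneg (hbound.trans ((ENNReal.toReal_mono hrhs hle).trans (le_of_eq ?_)))
  rw [ENNReal.toReal_mul, ENNReal.toReal_pow, ENNReal.toReal_ofReal (Real.exp_pos _).le]
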